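/- Let $n\ge 2$, $\alpha\in(0,2\pi)$ and let $$F(z,\bar z)=e^{i\alpha}z+\sum_{2\le j+k\le n}f_{j,k}z^j\bar z^k,\qquad f_{j,k}\in\mathbb C,$$ be a polynomial map of the plane $\mathbb R^2\cong\mathbb C$ of degree at most $n$. For a vector field of class $C^{n+1}$ near the origin of the form $X(z,\bar z)=i\alpha z+\sum_{2\le j+k\le n}a_{j,k}z^j\bar z^k+O(|z|^{n+1})$, the flow of $\dot z=X(z,\bar z)$ has an expansion $\varphi(t;z,\bar z)=e^{i\alpha t}z+\sum_{2\le j+k\le n}\varphi_{j,k}(t)z^j\bar z^k+O(|z|^{n+1})$, where $$\dot\varphi_{j,k}=i\alpha\varphi_{j,k}+a_{j,k}e^{i(j-k)\alpha t}+b_{j,k}(t),\qquad \varphi_{j,k}(0)=0,$$ and $b_{j,k}(t)$ is the coefficient of $z^j\bar z^k$ in $\sum_{2\le l+m<j+k}a_{l,m}\varphi^l\bar\varphi^m$; it depends only on the $a_{l,m}$ with $2\le l+m<j+k$. There is a resonance associated with $(j,k)$, $2\le j+k\le n$, if $j-k-1\ne0$ and $e^{i\alpha}$ is a $|j-k-1|$-th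 root of unity. The equations $\varphi_{j,k}(1)=f_{j,k}$ are solved recursively in the order $j+k$ for the $a_{j,k}$: the coefficient $a_{j,k}$ is determined by those of lower order if $(j,k)$ is not resonant, and if $(j,k)$ is resonant then $a_{j,k}$ is left free and the equation becomes the compatibility equation $$e^{i\alpha}\int_0^1 b_{j,k}(\tau)e^{-i\alpha\tau}\,d\tau=f_{j,k}.$$ This compatibility equation is said to be satisfied if it holds for all choices of the coefficients $a_{l,m}$, $2\le l+m<j+k$, that solve $\varphi_{l,m}(1)=f_{l,m}$ for all $2\le l+m<j+k$ (that is, identically in the parameters that are still free), and it is said to fail if it holds for no such choice. (i) If there is no resonance with $2\le j+k\le n$, then there is a unique polynomial vector field of the form $X=i\alpha z+\sum_{2\le j+k\le n}a_{j,k}z^j\bar z^k$ whose flow satisfies $\varphi(1;z,\bar z)=F(z,\bar z)+O(|z|^{n+1})$ as $z\to0$. (ii) If there is a resonance associated with some $(j,k)$, $2\le j+k\le n$, and the corresponding compatibility equation fails, then there is no vector field of class $C^{n+1}$ near the origin of the form $X=i\alpha z+O(|z|^2)$ whose flow satisfies $\varphi(1;z,\bar z)=F(z,\bar z)+O(|z|^{n+1})$.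 (iii) If there are exactly $\ell$ resonant couples $(j,k)$ with $2\le j+k\le n$ and all the corresponding compatibility equations are satisfied, then the polynomial vector fields of the form $X=i\alpha z+\sum_{2\le j+k\le n}a_{j,k}z^j\bar z^k$ whose flow satisfies $\varphi(1;z,\bar z)=F(z,\bar z)+O(|z|^{n+1})$ form an $\ell$-parameter family: the $\ell$ complex coefficients $a_{j,k}$ of the resonant couples are free parameters in $\mathbb C^\ell$, and the other coefficients are uniquely determined by them and depend continuously on them. -/

import Mathlib

open scoped Topology ComplexConjugate

namespace TimeOneFlow

noncomputable section

/-- The couples `(j, k)` of natural numbers with `2 ≤ j + k ≤ n`. -/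
def couples (n : ℕ) : Finset (ℕ × ℕ) :=
  (Finset.range (n + 1) ×ˢ Finset.range (n + 1)).filter
    (fun p => 2 ≤ p.1 + p.2 ∧ p.1 + p.2 ≤ n)

/-- The polynomial `c z + ∑_{2 ≤ j+k ≤ n} u_{j,k} z^j (conj z)^k`, as a map of the plane. -/
def planePoly (c : ℂ) (n : ℕ) (u : ℕ × ℕ → ℂ) (z : ℂ) : ℂ :=
  c * z + ∑ p ∈ couples n, u p * z ^ p.1 * conj z ^ p.2

/-- The map `F(z, conj z) = e^{iα} z + ∑_{2 ≤ j+k ≤ n} f_{j,k} z^j (conj z)^k`. -/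
def polyMap (α : ℝ) (n : ℕ) (f : ℕ × ℕ → ℂ) : ℂ → ℂ :=
  planePoly (Complex.exp (Complex.I * α)) n f

/-- The vector field `X(z, conj z) = iα z + ∑_{2 ≤ j+k ≤ n} a_{j,k} z^j (conj z)^k`. -/
def polyField (α : ℝ) (n : ℕ) (a : ℕ × ℕ → ℂ) : ℂ → ℂ :=
  planePoly (Complex.I * α) n a

/-- `u` is a family of coefficients indexed by the couples `2 ≤ j + k ≤ n`
(extended by zero to all couples). -/
def IsCoeffFamily (n : ℕ) (u : ℕ × ℕ → ℂ) : Prop :=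
  ∀ p, p ∉ couples n → u p = 0

/-- `φ t z` is, for all `z` near `0` and all `t ∈ [0, 1]`, the flow of the differential equation
`z' = X(z)`: the curve `t ↦ φ t z` solves it and starts at `z`. -/
def IsLocalFlow (X : ℂ → ℂ) (φ : ℝ → ℂ → ℂ) : Prop :=
  ∀ᶠ z in 𝓝 (0 : ℂ), φ 0 z = z ∧
    ∀ t ∈ Set.Icc (0 : ℝ) 1,
      HasDerivWithinAt (fun s => φ s z) (X (φ t z)) (Set.Icc (0 : ℝ) 1) t

/-- The flow of `X` satisfies `φ(1; z) = F(z) + O(|z|^(n+1))` as `z → 0`. -/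
def HasTimeOneMap (X F : ℂ → ℂ) (n : ℕ) : Prop :=
  ∃ φ : ℝ → ℂ → ℂ, IsLocalFlow X φ ∧
    (fun z => φ 1 z - F z) =O[𝓝 (0 : ℂ)] (fun z => ‖z‖ ^ (n + 1))

/-- `X` is a vector field of class `C^{n+1}` near the origin, of the form `iα z + O(|z|^2)`. -/
def IsFieldAtOrigin (α : ℝ) (n : ℕ) (X : ℂ → ℂ) : Prop :=
  ContDiffAt ℝ ((n + 1 : ℕ) : WithTop ℕ∞) X 0 ∧
    (fun z => X z - Complex.I * α * z) =O[𝓝 (0 : ℂ)] (fun z => ‖z‖ ^ 2)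

/-! ### Taylor coefficients of the flow

Polynomials in `z` and `conj z` are elements of `MvPolynomial (Fin 2) ℂ`, where the variable `0`
stands for `z` and the variable `1` for `conj z`. -/

/-- The exponent of the monomial `z^j (conj z)^k`. -/
def expo (p : ℕ × ℕ) : Fin 2 →₀ ℕ :=
  Finsupp.single 0 p.1 + Finsupp.single 1 p.2

/-- Complex conjugation of a polynomial in `z` and `conj z`: conjugate the coefficients and
exchange the two variables. -/
def conjPoly (P : MvPolynomial (Fin 2) ℂ) : MvPolynomial (Fin 2) ℂ :=
  MvPolynomial.rename (Equiv.swap (0 : Fin 2) 1) (MvPolynomial.map (starRingEnd ℂ) P)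

/-- The coefficient of `z^j (conj z)^k`, `p = (j, k)`, in
`∑_{2 ≤ l+m < j+k} a_{l,m} P^l (conj P)^m`. -/
def lowerTerms (a : ℕ × ℕ → ℂ) (P : MvPolynomial (Fin 2) ℂ) (p : ℕ × ℕ) : ℂ :=
  ∑ q ∈ (couples (p.1 + p.2)).filter (fun q => q.1 + q.2 < p.1 + p.2),
    a q * MvPolynomial.coeff (expo p) (P ^ q.1 * conjPoly P ^ q.2)

/-- The Taylor polynomial of order `κ` at the origin of `z ↦ φ(t; z)`, where `φ` is the flow of a
vector field `iα z + ∑ a_{j,k} z^j (conj z)^k`. It is computed order by order: its coefficient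
`φ_{j,k}` with `j + k ≥ 2` is the solution, given by variation of constants, of
`φ_{j,k}' = iα φ_{j,k} + a_{j,k} e^{i(j-k)αt} + b_{j,k}(t)`, `φ_{j,k}(0) = 0`,
where `b_{j,k}(t)` is the contribution of the coefficients of order less than `j + k`. -/
def flowJet (α : ℝ) (a : ℕ × ℕ → ℂ) : ℕ → ℝ → MvPolynomial (Fin 2) ℂ
  | 0 => fun _ => 0
  | 1 => fun t => MvPolynomial.monomial (expo (1, 0)) (Complex.exp (Complex.I * α * t))
  | κ + 2 => fun t => flowJet α a (κ + 1) t +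
      ∑ p ∈ (couples (κ + 2)).filter (fun p => p.1 + p.2 = κ + 2),
        MvPolynomial.monomial (expo p)
          (Complex.exp (Complex.I * α * t) *
            ∫ τ in (0 : ℝ)..t,
              (a p * Complex.exp (Complex.I * ((p.1 : ℂ) - (p.2 : ℂ)) * α * τ) +
                  lowerTerms a (flowJet α a (κ + 1) τ) p) *
                Complex.exp (-(Complex.I * α * τ)))

/-- The coefficient `φ_{j,k}(t)`, `p = (j, k)`, of the flow. -/
def flowCoeff (α : ℝ) (a : ℕ × ℕ → ℂ) (p : ℕ × ℕ) (t : ℝ) : ℂ :=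
  MvPolynomial.coeff (expo p) (flowJet α a (p.1 + p.2) t)

/-- The function `b_{j,k}(t)`, `p = (j, k)`, `j + k ≥ 2`. It depends only on the coefficients
`a_{l,m}` with `2 ≤ l + m < j + k`. -/
def lowerCoeff (α : ℝ) (a : ℕ × ℕ → ℂ) (p : ℕ × ℕ) (t : ℝ) : ℂ :=
  lowerTerms a (flowJet α a (p.1 + p.2 - 1) t) p

/-- There is a resonance associated with `a_{j,k}`, `p = (j, k)`: `j - k - 1 ≠ 0` and `e^{iα}` is
a `|j - k - 1|`-th root of unity. -/
def IsResonant (α : ℝ) (p : ℕ × ℕ) : Prop :=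
  (p.1 : ℤ) - p.2 - 1 ≠ 0 ∧
    Complex.exp (Complex.I * α) ^ ((p.1 : ℤ) - p.2 - 1).natAbs = 1

open scoped Classical in
/-- The resonant couples `(j, k)` with `2 ≤ j + k ≤ n`. -/
def resonances (α : ℝ) (n : ℕ) : Finset (ℕ × ℕ) :=
  (couples n).filter (IsResonant α)

/-- The compatibility equation corresponding to `a_{j,k}`, `p = (j, k)`, for given values of the
coefficients of lower order. -/
def CompatEq (α : ℝ) (f a : ℕ × ℕ → ℂ) (p : ℕ × ℕ) : Prop :=
  Complex.exp (Complex.I * α) *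
      ∫ τ in (0 : ℝ)..1, lowerCoeff α a p τ * Complex.exp (-(Complex.I * α * τ)) = f p

/-- The coefficients `a_{l,m}` with `2 ≤ l + m < d` are an outcome of the recursive procedure:
they solve all the equations `φ_{l,m}(1) = f_{l,m}` of order less than `d`. -/
def SolvesBelow (α : ℝ) (f a : ℕ × ℕ → ℂ) (d : ℕ) : Prop :=
  ∀ q : ℕ × ℕ, 2 ≤ q.1 + q.2 → q.1 + q.2 < d → flowCoeff α a q 1 = f q

/-- The compatibility equation corresponding to `a_{j,k}` is satisfied: it holds identically in
the parameters that the recursive procedure has left free at the orders less than `j + k`. -/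
def CompatSatisfied (α : ℝ) (f : ℕ × ℕ → ℂ) (p : ℕ × ℕ) : Prop :=
  ∀ a : ℕ × ℕ → ℂ, SolvesBelow α f a (p.1 + p.2) → CompatEq α f a p

/-- The compatibility equation corresponding to `a_{j,k}` fails: no values of the parameters that
the recursive procedure has left free at the orders less than `j + k` satisfy it. -/
def CompatFails (α : ℝ) (f : ℕ × ℕ → ℂ) (p : ℕ × ℕ) : Prop :=
  ∀ a : ℕ × ℕ → ℂ, SolvesBelow α f a (p.1 + p.2) → ¬ CompatEq α f a p

end

end TimeOneFlow

open TimeOneFlow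

namespace TimeOneFlow

open MvPolynomial

/-! ### Couples and exponents -/

/-! The flow is compared with an explicit polynomial `flowJet`, built order by order. Modulo terms
of order `n + 1` it solves the differential equation formally (`flowJetDeriv_sub_fieldPoly_mem`), so
Gronwall's inequality puts the true time-one map within `O(‖z‖ ^ (n + 1))` of `flowJet α a n 1`
(`isLocalFlow_sub_flowJet_isBigO`). Since a polynomial in `z` and `conj z` of degree at most `n`
that is `O(‖z‖ ^ (n + 1))` vanishes (`coeff_eq_zero_of_isBigO`), the condition on the time-one map
is equivalent, for polynomial fields, to the finite system `flowCoeff α a p 1 = f p`. A field of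
class `C^{n+1}` satisfies the same system through its Taylor polynomial.

The system is triangular: by `flowCoeff_one`, the equation at `p` is affine in `a p`, with constant
term depending only on lower orders and slope `∫₀¹ e^{i(j-k-1)ατ} dτ` up to the factor `e^{iα}`. The
slope vanishes exactly at a resonance. Otherwise `a p` is determined by division; at a resonance `a
p` drops out and the compatibility equation remains. All three parts follow by recursion on the
order. -/

theorem mem_couples {n : ℕ} {p : ℕ × ℕ} : p ∈ couples n ↔ 2 ≤ p.1 + p.2 ∧ p.1 + p.2 ≤ n := by
  simp only [couples, Finset.mem_filter, Finset.mem_product, Finset.mem_range]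
  omega

theorem degree_expo (p : ℕ × ℕ) : (expo p).degree = p.1 + p.2 := by
  simp [expo]

theorem expo_injective : Function.Injective expo := by
  intro p q h
  have h0 := DFunLike.congr_fun h 0
  have h1 := DFunLike.congr_fun h 1
  simp [expo] at h0 h1
  exact Prod.ext h0 h1

theorem expo_apply (m : Fin 2 →₀ ℕ) : expo (m 0, m 1) = m := by
  ext i
  fin_cases i <;> simp [expo]

theorem coeff_expo_monomial (p q : ℕ × ℕ) (c : ℂ) :
    coeff (expo p) (monomial (expo q) c) = if q = p then c else 0 := by
  rw [coeff_monomial]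
  simp [expo_injective.eq_iff]

theorem coeff_expo_sum_monomial (s : Finset (ℕ × ℕ)) (c : ℕ × ℕ → ℂ) (p : ℕ × ℕ) :
    coeff (expo p) (∑ q ∈ s, monomial (expo q) (c q)) = if p ∈ s then c p else 0 := by
  rw [coeff_sum, Finset.sum_congr rfl fun q _ => coeff_expo_monomial p q (c q)]
  simp

theorem sum_couples_succ {M : Type*} [AddCommMonoid M] (n : ℕ) (g : ℕ × ℕ → M) :
    ∑ p ∈ couples (n + 1), g p =
      ∑ p ∈ couples n, g p + ∑ p ∈ (couples (n + 1)).filter (fun p => p.1 + p.2 = n + 1), g p := by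
  rw [← Finset.sum_filter_add_sum_filter_not (couples (n + 1)) (fun p => p.1 + p.2 ≤ n)]
  congr 1 <;> refine Finset.sum_congr ?_ fun _ _ => rfl
  · ext p; simp only [Finset.mem_filter, mem_couples]; omega
  · ext p; simp only [Finset.mem_filter, mem_couples]; omega

theorem couples_one : couples 1 = ∅ := by
  ext p; simp only [mem_couples]; simp; omega

/-! ### The ideal of polynomials without constant term -/

/-- The ideal generated by `z` and `conj z`. -/
noncomputable abbrev varIdeal : Ideal (MvPolynomial (Fin 2) ℂ) := idealOfVars (Fin 2) ℂ

/-- Makes "order at least `n`" an ideal membership, so that truncation arguments become congruences.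
-/
theorem mem_varIdeal_pow_iff {n : ℕ} {P : MvPolynomial (Fin 2) ℂ} :
    P ∈ varIdeal ^ n ↔ ∀ p : ℕ × ℕ, p.1 + p.2 < n → coeff (expo p) P = 0 := by
  rw [mem_pow_idealOfVars_iff']
  constructor
  · intro h p hp
    exact h _ (by rwa [degree_expo])
  · intro h m hm
    have := h (m 0, m 1)
    rw [expo_apply, ← degree_expo, expo_apply] at this
    exact this hm

theorem monomial_expo_mem (p : ℕ × ℕ) (c : ℂ) {n : ℕ} (h : n ≤ p.1 + p.2) :
    monomial (expo p) c ∈ varIdeal ^ n := by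
  rw [mem_varIdeal_pow_iff]
  intro q hq
  rw [coeff_expo_monomial, if_neg]
  rintro rfl
  omega

/-- `conjPoly` as a ring homomorphism. -/
noncomputable def conjHom : MvPolynomial (Fin 2) ℂ →+* MvPolynomial (Fin 2) ℂ :=
  (rename (R := ℂ) (Equiv.swap (0 : Fin 2) 1)).toRingHom.comp (map (starRingEnd ℂ))

theorem conjPoly_eq (P : MvPolynomial (Fin 2) ℂ) : conjPoly P = conjHom P := rfl

theorem conjPoly_mem {n : ℕ} {P : MvPolynomial (Fin 2) ℂ} (h : P ∈ varIdeal ^ n) :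
    conjPoly P ∈ varIdeal ^ n := by
  have h1 : varIdeal.map conjHom ≤ varIdeal := by
    rw [Ideal.map_span, Ideal.span_le]
    rintro _ ⟨_, ⟨i, rfl⟩, rfl⟩
    have : conjHom (X i) = X (Equiv.swap (0 : Fin 2) 1 i) := by simp [conjHom]
    rw [this]
    exact Ideal.subset_span ⟨_, rfl⟩
  have h2 := Ideal.mem_map_of_mem conjHom h
  rw [Ideal.map_pow] at h2
  exact Ideal.pow_right_mono h1 n h2

theorem conjPoly_sub_mem {n : ℕ} {P Q : MvPolynomial (Fin 2) ℂ} (h : P - Q ∈ varIdeal ^ n) :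
    conjPoly P - conjPoly Q ∈ varIdeal ^ n := by
  rw [conjPoly_eq, conjPoly_eq, ← map_sub]
  exact conjPoly_mem h

theorem conjPoly_monomial (p : ℕ × ℕ) (c : ℂ) :
    conjPoly (monomial (expo p) c) = monomial (expo p.swap) (conj c) := by
  rw [conjPoly, map_monomial, rename_monomial]
  congr 1
  simp [expo, Finsupp.mapDomain_add, Finsupp.mapDomain_single, add_comm]

theorem expo_add (p q : ℕ × ℕ) : expo p + expo q = expo (p + q) := by
  ext i; fin_cases i <;> simp [expo]

theorem nsmul_expo (k : ℕ) (p : ℕ × ℕ) : k • expo p = expo (k • p) := by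
  ext i; fin_cases i <;> simp [expo]

/-- Telescoping: every difference term has one factor in `I ^ (d + 1)` and `i + j - 1` factors in
`I`. The gain over `d + 1` as soon as `i + j ≥ 2` is why nonlinear terms see only lower orders of
the flow. -/
theorem pow_mul_pow_sub_mem {R : Type*} [CommRing R] {I : Ideal R} {d : ℕ} {a b c e : R}
    (ha : a ∈ I) (hb : b ∈ I) (hc : c ∈ I) (he : e ∈ I) (hac : a - c ∈ I ^ (d + 1))
    (hbe : b - e ∈ I ^ (d + 1)) (i j : ℕ) : a ^ i * b ^ j - c ^ i * e ^ j ∈ I ^ (d + i + j) := by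
  induction i with
  | zero =>
    induction j with
    | zero => simp
    | succ j ih =>
      have h : a ^ 0 * b ^ (j + 1) - c ^ 0 * e ^ (j + 1) =
          b * (a ^ 0 * b ^ j - c ^ 0 * e ^ j) + (b - e) * e ^ j := by ring
      rw [h]
      refine add_mem ?_ ?_
      · rw [show d + 0 + (j + 1) = 1 + (d + 0 + j) by ring, pow_add, pow_one]
        exact Ideal.mul_mem_mul hb ih
      · rw [show d + 0 + (j + 1) = (d + 1) + j by ring, pow_add]
        exact Ideal.mul_mem_mul hbe (Ideal.pow_mem_pow he _)
  | succ i ih =>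
    have h : a ^ (i + 1) * b ^ j - c ^ (i + 1) * e ^ j =
        a * (a ^ i * b ^ j - c ^ i * e ^ j) + (a - c) * (c ^ i * e ^ j) := by ring
    rw [h]
    refine add_mem ?_ ?_
    · rw [show d + (i + 1) + j = 1 + (d + i + j) by ring, pow_add, pow_one]
      exact Ideal.mul_mem_mul ha ih
    · rw [show d + (i + 1) + j = (d + 1) + (i + j) by ring, pow_add, pow_add I i j]
      exact Ideal.mul_mem_mul hac
        (Ideal.mul_mem_mul (Ideal.pow_mem_pow hc _) (Ideal.pow_mem_pow he _))

/-! ### The Taylor polynomial of the flow -/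

/-- The recursion unrolled: `lowerCoeff` truncates at order `p.1 + p.2 - 1`, exactly the stage
available when the coefficient at `p` is created. -/
theorem flowJet_succ_of_variation (α : ℝ) (a : ℕ × ℕ → ℂ) (κ : ℕ) (t : ℝ) :
    flowJet α a (κ + 1) t = monomial (expo (1, 0)) (Complex.exp (Complex.I * α * t)) +
      ∑ p ∈ couples (κ + 1), monomial (expo p) (Complex.exp (Complex.I * α * t) *
            ∫ τ in (0 : ℝ)..t,
              (a p * Complex.exp (Complex.I * ((p.1 : ℂ) - (p.2 : ℂ)) * α * τ) +
                  lowerCoeff α a p τ) * Complex.exp (-(Complex.I * α * τ))) := by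
  induction κ with
  | zero => simp [couples_one, flowJet]
  | succ κ ih =>
    rw [sum_couples_succ, ← add_assoc, ← ih]
    rw [show κ + 1 + 1 = κ + 2 from rfl, flowJet]
    refine congrArg (flowJet α a (κ + 1) t + ·) (Finset.sum_congr rfl fun p hp => ?_)
    have hp' := (Finset.mem_filter.1 hp).2
    have h : ∀ τ, lowerCoeff α a p τ = lowerTerms a (flowJet α a (κ + 1) τ) p := by
      intro τ
      rw [lowerCoeff, hp']
      rfl
    simp only [h]

theorem flowCoeff_eq (α : ℝ) (a : ℕ × ℕ → ℂ) {p : ℕ × ℕ} (hp : 2 ≤ p.1 + p.2) (t : ℝ) :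
    flowCoeff α a p t = Complex.exp (Complex.I * α * t) *
            ∫ τ in (0 : ℝ)..t,
              (a p * Complex.exp (Complex.I * ((p.1 : ℂ) - (p.2 : ℂ)) * α * τ) +
                  lowerCoeff α a p τ) * Complex.exp (-(Complex.I * α * τ)) := by
  obtain ⟨κ, hκ⟩ : ∃ κ, p.1 + p.2 = κ + 1 := ⟨p.1 + p.2 - 1, by omega⟩
  rw [flowCoeff, hκ, flowJet_succ_of_variation, coeff_add, coeff_expo_monomial,
    coeff_expo_sum_monomial, if_neg, if_pos, zero_add]
  · rw [mem_couples]; omega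
  · rintro rfl
    simp at hp

theorem flowJet_eq (α : ℝ) (a : ℕ × ℕ → ℂ) {n : ℕ} (hn : 1 ≤ n) (t : ℝ) :
    flowJet α a n t = monomial (expo (1, 0)) (Complex.exp (Complex.I * α * t)) +
      ∑ p ∈ couples n, monomial (expo p) (flowCoeff α a p t) := by
  obtain ⟨κ, rfl⟩ : ∃ κ, n = κ + 1 := ⟨n - 1, by omega⟩
  rw [flowJet_succ_of_variation]
  congr 1
  refine Finset.sum_congr rfl fun p hp => ?_
  rw [flowCoeff_eq α a (mem_couples.1 hp).1]

theorem flowJet_mem (α : ℝ) (a : ℕ × ℕ → ℂ) (n : ℕ) (t : ℝ) : flowJet α a n t ∈ varIdeal := by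
  rcases Nat.eq_zero_or_pos n with rfl | hn
  · simp [flowJet]
  rw [flowJet_eq α a hn, ← pow_one varIdeal]
  refine add_mem (monomial_expo_mem _ _ (by simp)) (sum_mem fun p hp => monomial_expo_mem _ _ ?_)
  have := (mem_couples.1 hp).1
  omega

theorem flowJet_sub_mem (α : ℝ) (a : ℕ × ℕ → ℂ) {m n : ℕ} (hm : 1 ≤ m) (hmn : m ≤ n) (t : ℝ) :
    flowJet α a n t - flowJet α a m t ∈ varIdeal ^ (m + 1) := by
  rw [mem_varIdeal_pow_iff]
  intro p hp
  rw [flowJet_eq α a hm, flowJet_eq α a (hm.trans hmn), coeff_sub, coeff_add, coeff_add,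
    coeff_expo_sum_monomial, coeff_expo_sum_monomial]
  have : p ∈ couples n ↔ p ∈ couples m := by simp only [mem_couples]; omega
  simp [this]

/-- If `q` has lower order than `p`, truncating the jet at order `p.1 + p.2 - 1` loses nothing,
because the product has at least two factors. If the orders agree, only the linear part `e^{iαt} z`
contributes, and only for `q = p`. If `q` has higher order, the coefficient is zero. -/
theorem coeff_pow_mul_conjPoly_pow (α : ℝ) (a : ℕ × ℕ → ℂ) {n : ℕ} {p q : ℕ × ℕ}
    (hp : p ∈ couples n) (hq : q ∈ couples n) (t : ℝ) :
    coeff (expo p) (flowJet α a n t ^ q.1 * conjPoly (flowJet α a n t) ^ q.2) =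
      (if q.1 + q.2 < p.1 + p.2 then coeff (expo p) (flowJet α a (p.1 + p.2 - 1) t ^ q.1 *
        conjPoly (flowJet α a (p.1 + p.2 - 1) t) ^ q.2) else 0) +
      if q = p then Complex.exp (Complex.I * ((p.1 : ℂ) - (p.2 : ℂ)) * α * t) else 0 := by
  rw [mem_couples] at hp hq
  have hI : ∀ m, flowJet α a m t ∈ varIdeal ^ 1 := fun m => by
    rw [pow_one]; exact flowJet_mem α a m t
  have hJ : ∀ m, conjPoly (flowJet α a m t) ∈ varIdeal := fun m => by
    have := conjPoly_mem (hI m)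
    rwa [pow_one] at this
  have key : ∀ m, 1 ≤ m → m ≤ n → p.1 + p.2 < m + (q.1 + q.2) →
      coeff (expo p) (flowJet α a n t ^ q.1 * conjPoly (flowJet α a n t) ^ q.2) =
      coeff (expo p) (flowJet α a m t ^ q.1 * conjPoly (flowJet α a m t) ^ q.2) := by
    intro m hm hmn hlt
    have h1 := flowJet_sub_mem α a hm hmn t
    have h2 := pow_mul_pow_sub_mem (flowJet_mem α a n t) (hJ n) (flowJet_mem α a m t) (hJ m)
      h1 (conjPoly_sub_mem h1) q.1 q.2
    have h3 := mem_varIdeal_pow_iff.1 h2 p (by omega)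
    rwa [coeff_sub, sub_eq_zero] at h3
  split_ifs with h1 h2 h2
  · subst h2; omega
  · rw [key (p.1 + p.2 - 1) (by omega) (by omega) (by omega), add_zero]
  · subst h2
    rw [key 1 le_rfl (by omega) (by omega)]
    have hJ1 : flowJet α a 1 t =
        monomial (expo (1, 0)) (Complex.exp (Complex.I * α * t)) := rfl
    rw [hJ1, conjPoly_monomial, monomial_pow, monomial_pow,
      monomial_mul, nsmul_expo, nsmul_expo, expo_add, coeff_expo_monomial, if_pos, zero_add,
      ← Complex.exp_conj, ← Complex.exp_nat_mul, ← Complex.exp_nat_mul, ← Complex.exp_add]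
    · congr 1
      simp
      ring
    · ext <;> simp
  · rw [add_zero]
    rcases Nat.lt_or_ge (p.1 + p.2) (q.1 + q.2) with h | h
    · have h3 : flowJet α a n t ^ q.1 * conjPoly (flowJet α a n t) ^ q.2 ∈
          varIdeal ^ (q.1 + q.2) := by
        rw [pow_add]
        exact Ideal.mul_mem_mul (Ideal.pow_mem_pow (flowJet_mem α a n t) _)
          (Ideal.pow_mem_pow (hJ n) _)
      exact mem_varIdeal_pow_iff.1 h3 p h
    · rw [key 1 le_rfl (by omega) (by omega)]
      have hJ1 : flowJet α a 1 t =
          monomial (expo (1, 0)) (Complex.exp (Complex.I * α * t)) := rfl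
      rw [hJ1, conjPoly_monomial, monomial_pow, monomial_pow,
        monomial_mul, nsmul_expo, nsmul_expo, expo_add, coeff_expo_monomial, if_neg]
      intro h4
      apply h2
      rw [← h4]
      ext <;> simp

/-- The polynomial in `z` and `conj z` obtained by substituting `P` for `z` in the vector field. -/
noncomputable def fieldPoly (α : ℝ) (n : ℕ) (a : ℕ × ℕ → ℂ) (P : MvPolynomial (Fin 2) ℂ) :
    MvPolynomial (Fin 2) ℂ :=
  C (Complex.I * α) * P + ∑ q ∈ couples n, C (a q) * (P ^ q.1 * conjPoly P ^ q.2)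

/-- The derivative of the Taylor polynomial of the flow with respect to the time. -/
noncomputable def flowJetDeriv (α : ℝ) (a : ℕ × ℕ → ℂ) (n : ℕ) (t : ℝ) :
    MvPolynomial (Fin 2) ℂ :=
  C (Complex.I * α) * flowJet α a n t + ∑ p ∈ couples n, monomial (expo p)
    (a p * Complex.exp (Complex.I * ((p.1 : ℂ) - (p.2 : ℂ)) * α * t) + lowerCoeff α a p t)

/-- The formal flow equation: coefficient by coefficient, the substituted field reproduces the
forcing terms used to define the jet. -/
theorem flowJetDeriv_sub_fieldPoly_mem (α : ℝ) (a : ℕ × ℕ → ℂ) (n : ℕ) (t : ℝ) :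
    flowJetDeriv α a n t - fieldPoly α n a (flowJet α a n t) ∈ varIdeal ^ (n + 1) := by
  rw [flowJetDeriv, fieldPoly, add_sub_add_left_eq_sub, mem_varIdeal_pow_iff]
  intro p hp
  rw [coeff_sub, coeff_expo_sum_monomial]
  by_cases hpc : p ∈ couples n
  · rw [if_pos hpc, coeff_sum]
    simp only [coeff_C_mul]
    rw [Finset.sum_congr rfl fun q hq => by
      rw [coeff_pow_mul_conjPoly_pow α a hpc hq t, mul_add, mul_ite, mul_ite, mul_zero]]
    rw [Finset.sum_add_distrib, Finset.sum_ite_eq' , if_pos hpc, ← Finset.sum_filter, lowerCoeff,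
      lowerTerms]
    have : (couples n).filter (fun q => q.1 + q.2 < p.1 + p.2) =
        (couples (p.1 + p.2)).filter (fun q => q.1 + q.2 < p.1 + p.2) := by
      ext q
      simp only [Finset.mem_filter, mem_couples]
      omega
    rw [this]
    ring
  -- Here `p` has order at most 1, while the nonlinear part of the field has order at least 2.
  · rw [if_neg hpc, zero_sub, neg_eq_zero]
    have h : ∑ q ∈ couples n, C (a q) *
        (flowJet α a n t ^ q.1 * conjPoly (flowJet α a n t) ^ q.2) ∈ varIdeal ^ 2 := by
      refine sum_mem fun q hq => Ideal.mul_mem_left _ _ ?_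
      refine Ideal.pow_le_pow_right (mem_couples.1 hq).1 ?_
      rw [pow_add]
      refine Ideal.mul_mem_mul (Ideal.pow_mem_pow (flowJet_mem α a n t) _)
          (Ideal.pow_mem_pow ?_ _)
      have h4 := flowJet_mem α a n t
      rw [← pow_one varIdeal] at h4 ⊢
      exact conjPoly_mem h4
    refine mem_varIdeal_pow_iff.1 h p ?_
    rw [mem_couples] at hpc
    omega

/-- The Taylor polynomial of order `κ` depends only on the coefficients of order at most `κ`. -/
theorem flowJet_congr (α : ℝ) {a b : ℕ × ℕ → ℂ} (κ : ℕ)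
    (h : ∀ p : ℕ × ℕ, 2 ≤ p.1 + p.2 → p.1 + p.2 ≤ κ → a p = b p) :
    flowJet α a κ = flowJet α b κ := by
  induction κ using Nat.strong_induction_on with
  | _ κ ih =>
    match κ with
    | 0 => rfl
    | 1 => rfl
    | κ + 2 =>
      funext t
      have h1 := ih (κ + 1) (by omega) fun p h2 h3 => h p h2 (by omega)
      simp only [flowJet]
      rw [h1]
      congr 1
      refine Finset.sum_congr rfl fun p hp => ?_
      simp only [Finset.mem_filter, mem_couples] at hp
      rw [h p hp.1.1 hp.1.2]
      have h2 : ∀ P, lowerTerms a P p = lowerTerms b P p := by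
        intro P
        refine Finset.sum_congr rfl fun q hq => ?_
        simp only [Finset.mem_filter, mem_couples] at hq
        rw [h q hq.1.1 (by omega)]
      simp only [h2]

theorem lowerCoeff_congr (α : ℝ) {a b : ℕ × ℕ → ℂ} {p : ℕ × ℕ}
    (h : ∀ q : ℕ × ℕ, 2 ≤ q.1 + q.2 → q.1 + q.2 < p.1 + p.2 → a q = b q) :
    lowerCoeff α a p = lowerCoeff α b p := by
  funext t
  rw [lowerCoeff, lowerCoeff]
  have h0 : flowJet α a (p.1 + p.2 - 1) = flowJet α b (p.1 + p.2 - 1) :=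
    flowJet_congr α _ fun q h1 h2 => h q h1 (by omega)
  rw [h0]
  refine Finset.sum_congr rfl fun q hq => ?_
  simp only [Finset.mem_filter, mem_couples] at hq
  rw [h q hq.1.1 hq.2]

/-! ### Polynomials depending continuously on a parameter -/

section ContPoly

variable {S T : Type*} [TopologicalSpace S] [TopologicalSpace T]

/-- Evaluation of continuous functions at a point. -/
noncomputable def evalAt (t : T) : C(T, ℂ) →+* ℂ :=
  (Pi.evalRingHom (fun _ : T => ℂ) t).comp ContinuousMap.coeFnRingHom

theorem evalAt_apply (t : T) (g : C(T, ℂ)) : evalAt t g = g t := rfl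

/-- A family of polynomials of uniformly bounded degree, whose coefficients depend continuously on
the parameter. -/
def ContPoly (P : T → MvPolynomial (Fin 2) ℂ) : Prop :=
  ∃ Q : MvPolynomial (Fin 2) C(T, ℂ), ∀ t, map (evalAt t) Q = P t

theorem ContPoly.add {P Q : T → MvPolynomial (Fin 2) ℂ} (hP : ContPoly P) (hQ : ContPoly Q) :
    ContPoly fun t => P t + Q t := by
  obtain ⟨P', hP⟩ := hP
  obtain ⟨Q', hQ⟩ := hQ
  exact ⟨P' + Q', fun t => by rw [map_add, hP, hQ]⟩

theorem ContPoly.sub {P Q : T → MvPolynomial (Fin 2) ℂ} (hP : ContPoly P) (hQ : ContPoly Q) :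
    ContPoly fun t => P t - Q t := by
  obtain ⟨P', hP⟩ := hP
  obtain ⟨Q', hQ⟩ := hQ
  exact ⟨P' - Q', fun t => by rw [map_sub, hP, hQ]⟩

theorem ContPoly.mul {P Q : T → MvPolynomial (Fin 2) ℂ} (hP : ContPoly P) (hQ : ContPoly Q) :
    ContPoly fun t => P t * Q t := by
  obtain ⟨P', hP⟩ := hP
  obtain ⟨Q', hQ⟩ := hQ
  exact ⟨P' * Q', fun t => by rw [map_mul, hP, hQ]⟩

theorem ContPoly.pow {P : T → MvPolynomial (Fin 2) ℂ} (hP : ContPoly P) (k : ℕ) :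
    ContPoly fun t => P t ^ k := by
  obtain ⟨P', hP⟩ := hP
  exact ⟨P' ^ k, fun t => by rw [map_pow, hP]⟩

theorem ContPoly.sum {ι : Type*} {s : Finset ι} {P : ι → T → MvPolynomial (Fin 2) ℂ}
    (hP : ∀ i ∈ s, ContPoly (P i)) : ContPoly fun t => ∑ i ∈ s, P i t := by
  choose! P' hP using hP
  exact ⟨∑ i ∈ s, P' i, fun t => by
    rw [map_sum]; exact Finset.sum_congr rfl fun i hi => hP i hi t⟩

theorem contPoly_monomial (m : Fin 2 →₀ ℕ) {c : T → ℂ} (hc : Continuous c) :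
    ContPoly fun t => monomial m (c t) :=
  ⟨monomial m ⟨c, hc⟩, fun t => by rw [map_monomial]; rfl⟩

theorem contPoly_C {c : T → ℂ} (hc : Continuous c) :
    ContPoly fun t => (C (c t) : MvPolynomial (Fin 2) ℂ) :=
  contPoly_monomial 0 hc

theorem ContPoly.conj {P : T → MvPolynomial (Fin 2) ℂ} (hP : ContPoly P) :
    ContPoly fun t => conjPoly (P t) := by
  obtain ⟨P', hP⟩ := hP
  refine ⟨rename (Equiv.swap (0 : Fin 2) 1) (map (starRingEnd C(T, ℂ)) P'), fun t => ?_⟩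
  change _ = conjPoly (P t)
  rw [← hP, map_rename, map_map]
  simp only [conjPoly]
  rw [map_map]
  rfl

theorem ContPoly.comp {P : T → MvPolynomial (Fin 2) ℂ} (hP : ContPoly P) {g : S → T}
    (hg : Continuous g) : ContPoly fun s => P (g s) := by
  obtain ⟨P', hP⟩ := hP
  refine ⟨map (ContinuousMap.compRightAlgHom ℂ ℂ ⟨g, hg⟩ : C(T, ℂ) →+* C(S, ℂ)) P', fun s => ?_⟩
  rw [map_map]
  exact hP (g s)

theorem ContPoly.continuous_coeff {P : T → MvPolynomial (Fin 2) ℂ} (hP : ContPoly P)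
    (m : Fin 2 →₀ ℕ) : Continuous fun t => coeff m (P t) := by
  obtain ⟨P', hP⟩ := hP
  simp only [← hP, coeff_map, evalAt_apply]
  exact (coeff m P').continuous

/-- The value of a polynomial in `z` and `conj z` at a point of the plane. -/
noncomputable def planeEval (z : ℂ) : MvPolynomial (Fin 2) ℂ →+* ℂ := eval ![z, conj z]

theorem planeEval_monomial (z : ℂ) (p : ℕ × ℕ) (c : ℂ) :
    planeEval z (monomial (expo p) c) = c * z ^ p.1 * conj z ^ p.2 := by
  rw [planeEval, eval_monomial, Finsupp.prod_fintype _ _ (by simp)]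
  simp [expo, mul_assoc]

theorem planeEval_C (z c : ℂ) : planeEval z (C c) = c := eval_C c

theorem planeEval_conjPoly (z : ℂ) (P : MvPolynomial (Fin 2) ℂ) :
    planeEval z (conjPoly P) = conj (planeEval z P) := by
  rw [planeEval, conjPoly, eval_rename, eval_map]
  have : (![z, conj z] ∘ Equiv.swap (0 : Fin 2) 1) = conj ∘ ![z, conj z] := by
    funext i
    fin_cases i <;> simp
  rw [this]
  exact (eval₂_comp_left (starRingEnd ℂ) (RingHom.id ℂ) ![z, conj z] P).symm

/-- A single polynomial over `C(T, ℂ)` has one finite support for all parameters, and each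
coefficient is bounded on `K`. Monomials of order below `d` vanish; for `‖z‖ ≤ 1` the others are
dominated by `‖z‖ ^ d`. -/
theorem ContPoly.exists_norm_planeEval_le {P : T → MvPolynomial (Fin 2) ℂ} (hP : ContPoly P)
    {d : ℕ} (hd : ∀ t, P t ∈ varIdeal ^ d) {K : Set T} (hK : IsCompact K) :
    ∃ B, 0 ≤ B ∧ ∀ t ∈ K, ∀ z : ℂ, ‖z‖ ≤ 1 → ‖planeEval z (P t)‖ ≤ B * ‖z‖ ^ d := by
  obtain ⟨P', hP⟩ := hP
  have h1 : ∀ m : Fin 2 →₀ ℕ, ∃ B, 0 ≤ B ∧ ∀ t ∈ K, ‖coeff m P' t‖ ≤ B := by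
    intro m
    obtain ⟨B, hB⟩ := hK.exists_bound_of_continuousOn (coeff m P').continuous.continuousOn
    exact ⟨max B 0, le_max_right _ _, fun t ht => (hB t ht).trans (le_max_left _ _)⟩
  choose B hB0 hB using h1
  refine ⟨∑ m ∈ P'.support, B m, Finset.sum_nonneg fun m _ => hB0 m, fun t ht z hz => ?_⟩
  rw [← hP, planeEval, eval_map, eval₂_eq', Finset.sum_mul]
  refine norm_sum_le_of_le _ fun m _ => ?_
  rw [Fin.prod_univ_two]
  simp only [Matrix.cons_val_zero, Matrix.cons_val_one, evalAt_apply, norm_mul, norm_pow,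
    RCLike.norm_conj, ← pow_add]
  by_cases hm : m 0 + m 1 < d
  · have h2 := mem_varIdeal_pow_iff.1 (hd t) (m 0, m 1) hm
    rw [expo_apply, ← hP, coeff_map, evalAt_apply] at h2
    rw [h2, norm_zero, zero_mul]
    exact mul_nonneg (hB0 m) (by positivity)
  · exact mul_le_mul (hB m t ht) (pow_le_pow_of_le_one (norm_nonneg _) hz (by omega))
      (by positivity) (hB0 m)

end ContPoly

/-! ### Regularity of the Taylor polynomial of the flow -/

theorem continuous_lowerTerms {κ : ℕ} {α : ℝ}
    (h : ContPoly fun x : (ℕ × ℕ → ℂ) × ℝ => flowJet α x.1 κ x.2) (p : ℕ × ℕ) :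
    Continuous fun x : (ℕ × ℕ → ℂ) × ℝ => lowerTerms x.1 (flowJet α x.1 κ x.2) p := by
  refine continuous_finsetSum _ fun q _ => Continuous.mul (by fun_prop) ?_
  exact ((h.pow q.1).mul (h.conj.pow q.2)).continuous_coeff (expo p)

/-- Joint continuity serves twice: in time, for uniform bounds on `[0, 1]`; in the coefficients, for
the continuous dependence on the free parameters. -/
theorem contPoly_flowJet (α : ℝ) (κ : ℕ) :
    ContPoly fun x : (ℕ × ℕ → ℂ) × ℝ => flowJet α x.1 κ x.2 := by
  induction κ using Nat.strong_induction_on with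
  | _ κ ih =>
    match κ with
    | 0 => exact ⟨0, fun t => by simp [flowJet]⟩
    | 1 => exact contPoly_monomial _ (by fun_prop)
    | κ + 2 =>
      simp only [flowJet]
      have h1 := ih (κ + 1) (by omega)
      refine h1.add (ContPoly.sum fun p _ => contPoly_monomial _ (Continuous.mul (by fun_prop) ?_))
      have h2 := continuous_lowerTerms h1 p
      refine intervalIntegral.continuous_parametric_intervalIntegral_of_continuous
        (f := fun (x : (ℕ × ℕ → ℂ) × ℝ) (τ : ℝ) =>
          (x.1 p * Complex.exp (Complex.I * ((p.1 : ℂ) - (p.2 : ℂ)) * α * τ) +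
            lowerTerms x.1 (flowJet α x.1 (κ + 1) τ) p) * Complex.exp (-(Complex.I * α * τ)))
        ?_ continuous_snd
      have h3 : Continuous fun x : ((ℕ × ℕ → ℂ) × ℝ) × ℝ =>
          lowerTerms x.1.1 (flowJet α x.1.1 (κ + 1) x.2) p :=
        h2.comp (f := fun x : ((ℕ × ℕ → ℂ) × ℝ) × ℝ => (x.1.1, x.2)) (by fun_prop)
      simp only [Function.uncurry_def]
      fun_prop

theorem continuous_lowerCoeff_uncurry (α : ℝ) (p : ℕ × ℕ) :
    Continuous fun x : (ℕ × ℕ → ℂ) × ℝ => lowerCoeff α x.1 p x.2 :=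
  continuous_lowerTerms (contPoly_flowJet α _) p

theorem continuous_lowerCoeff (α : ℝ) (a : ℕ × ℕ → ℂ) (p : ℕ × ℕ) :
    Continuous (lowerCoeff α a p) :=
  (continuous_lowerCoeff_uncurry α p).comp (f := fun t : ℝ => (a, t)) (by fun_prop)

theorem contPoly_flowJet_time (α : ℝ) (a : ℕ × ℕ → ℂ) (n : ℕ) :
    ContPoly fun t : ℝ => flowJet α a n t :=
  (contPoly_flowJet α n).comp (g := fun t : ℝ => (a, t)) (by fun_prop)

theorem hasDerivAt_flowCoeff (α : ℝ) (a : ℕ × ℕ → ℂ) {p : ℕ × ℕ} (hp : 2 ≤ p.1 + p.2) (t : ℝ) :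
    HasDerivAt (flowCoeff α a p) (Complex.I * α * flowCoeff α a p t +
      (a p * Complex.exp (Complex.I * ((p.1 : ℂ) - (p.2 : ℂ)) * α * t) + lowerCoeff α a p t)) t := by
  have h0 : flowCoeff α a p = fun t => _ := funext fun t => flowCoeff_eq α a hp t
  have hc := continuous_lowerCoeff α a p
  have h1 : HasDerivAt (fun t : ℝ => Complex.exp (Complex.I * α * t))
      (Complex.exp (Complex.I * α * t) * (Complex.I * α)) t := by
    have := ((Complex.ofRealCLM.hasDerivAt (x := t)).const_mul (Complex.I * α)).cexp
    simpa using this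
  have hg : Continuous fun τ : ℝ => (a p * Complex.exp (Complex.I * ((p.1 : ℂ) - (p.2 : ℂ)) * α * τ) +
      lowerCoeff α a p τ) * Complex.exp (-(Complex.I * α * τ)) := by fun_prop
  have h2 := h1.mul (intervalIntegral.integral_hasDerivAt_right (hg.intervalIntegrable 0 t)
    (hg.stronglyMeasurableAtFilter _ _) hg.continuousAt)
  rw [h0]
  refine h2.congr_deriv ?_
  have h3 : Complex.exp (Complex.I * α * t) * Complex.exp (-(Complex.I * α * t)) = 1 := by
    rw [← Complex.exp_add]; simp
  linear_combination (a p * Complex.exp (Complex.I * ((p.1 : ℂ) - (p.2 : ℂ)) * α * t) +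
      lowerCoeff α a p t) * h3

/-! ### The Taylor polynomial as an approximate solution in the plane -/

theorem planeEval_fieldPoly (α : ℝ) (n : ℕ) (a : ℕ × ℕ → ℂ) (P : MvPolynomial (Fin 2) ℂ) (z : ℂ) :
    planeEval z (fieldPoly α n a P) = polyField α n a (planeEval z P) := by
  simp only [fieldPoly, polyField, planePoly, map_add, map_sum, map_mul, map_pow, planeEval_C,
    planeEval_conjPoly, mul_assoc]

theorem planeEval_flowJet (α : ℝ) (a : ℕ × ℕ → ℂ) {n : ℕ} (hn : 1 ≤ n) (t : ℝ) (z : ℂ) :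
    planeEval z (flowJet α a n t) =
      planePoly (Complex.exp (Complex.I * α * t)) n (fun p => flowCoeff α a p t) z := by
  rw [flowJet_eq α a hn, map_add, map_sum, planePoly]
  simp only [planeEval_monomial, pow_one, pow_zero, mul_one]

theorem flowCoeff_zero (α : ℝ) (a : ℕ × ℕ → ℂ) {p : ℕ × ℕ} (hp : 2 ≤ p.1 + p.2) :
    flowCoeff α a p 0 = 0 := by
  rw [flowCoeff_eq α a hp, intervalIntegral.integral_same, mul_zero]

theorem planeEval_flowJet_zero (α : ℝ) (a : ℕ × ℕ → ℂ) {n : ℕ} (hn : 1 ≤ n) (z : ℂ) :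
    planeEval z (flowJet α a n 0) = z := by
  rw [planeEval_flowJet α a hn, planePoly, Finset.sum_eq_zero]
  · simp
  · intro p hp
    rw [flowCoeff_zero α a (mem_couples.1 hp).1]
    simp

theorem hasDerivAt_planeEval_flowJet (α : ℝ) (a : ℕ × ℕ → ℂ) {n : ℕ} (hn : 1 ≤ n) (t : ℝ)
    (z : ℂ) : HasDerivAt (fun t => planeEval z (flowJet α a n t))
      (planeEval z (flowJetDeriv α a n t)) t := by
  have h1 : HasDerivAt (fun t : ℝ => Complex.exp (Complex.I * α * t))
      (Complex.exp (Complex.I * α * t) * (Complex.I * α)) t := by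
    have := ((Complex.ofRealCLM.hasDerivAt (x := t)).const_mul (Complex.I * α)).cexp
    simpa using this
  simp only [planeEval_flowJet α a hn, planePoly]
  refine ((h1.mul_const z).add (HasDerivAt.fun_sum fun p hp =>
    ((hasDerivAt_flowCoeff α a (mem_couples.1 hp).1 t).mul_const _).mul_const _)).congr_deriv ?_
  simp only [flowJetDeriv, map_add, map_mul, map_sum, planeEval_C, planeEval_flowJet α a hn,
    planeEval_monomial, planePoly, mul_add, Finset.mul_sum, add_assoc, ← Finset.sum_add_distrib]
  congr 1
  · ring
  · exact Finset.sum_congr rfl fun p _ => by ring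

theorem exists_norm_flowJetDeriv_sub_le (α : ℝ) (a : ℕ × ℕ → ℂ) {n : ℕ} :
    ∃ B, 0 ≤ B ∧ ∀ t ∈ Set.Icc (0 : ℝ) 1, ∀ z : ℂ, ‖z‖ ≤ 1 →
      ‖planeEval z (flowJetDeriv α a n t) - polyField α n a (planeEval z (flowJet α a n t))‖ ≤
        B * ‖z‖ ^ (n + 1) := by
  have hJ := contPoly_flowJet_time α a n
  have h1 : ContPoly fun t => flowJetDeriv α a n t := by
    refine ((contPoly_C continuous_const).mul hJ).add
      (ContPoly.sum fun p _ => contPoly_monomial _ ?_)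
    have := continuous_lowerCoeff α a p
    fun_prop
  have h2 : ContPoly fun t => fieldPoly α n a (flowJet α a n t) :=
    ((contPoly_C continuous_const).mul hJ).add
      (ContPoly.sum fun q _ => (contPoly_C continuous_const).mul
        ((hJ.pow q.1).mul (hJ.conj.pow q.2)))
  obtain ⟨B, hB0, hB⟩ := (h1.sub h2).exists_norm_planeEval_le
    (flowJetDeriv_sub_fieldPoly_mem α a n) isCompact_Icc
  refine ⟨B, hB0, fun t ht z hz => ?_⟩
  have := hB t ht z hz
  rwa [map_sub, planeEval_fieldPoly] at this

theorem exists_norm_flowJet_le (α : ℝ) (a : ℕ × ℕ → ℂ) {n : ℕ} :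
    ∃ B, 0 ≤ B ∧ ∀ t ∈ Set.Icc (0 : ℝ) 1, ∀ z : ℂ, ‖z‖ ≤ 1 →
      ‖planeEval z (flowJet α a n t)‖ ≤ B * ‖z‖ := by
  obtain ⟨B, hB0, hB⟩ := (contPoly_flowJet_time α a n).exists_norm_planeEval_le (d := 1)
    (fun t => by rw [pow_one]; exact flowJet_mem α a n t) (isCompact_Icc (a := (0 : ℝ)) (b := 1))
  simp only [pow_one] at hB
  exact ⟨B, hB0, hB⟩

/-! ### Uniqueness of Taylor coefficients -/

/-- Once the lower coefficients vanish, divide by `r ^ d` and let `r → 0`. -/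
theorem polynomial_coeff_eq_zero_of_norm_eval_le {Q : Polynomial ℂ} {n : ℕ} {B : ℝ}
    (h : ∀ᶠ r : ℝ in 𝓝[>] 0, ‖Q.eval (r : ℂ)‖ ≤ B * r ^ (n + 1)) {d : ℕ} (hd : d ≤ n) :
    Q.coeff d = 0 := by
  induction d using Nat.strong_induction_on with
  | _ d ih =>
    obtain ⟨R, rfl⟩ := Polynomial.X_pow_dvd_iff.2 fun k hk => ih k hk (by omega)
    have h0 : (Polynomial.X ^ d * R).coeff d = R.eval 0 := by
      rw [← Polynomial.coeff_zero_eq_eval_zero]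
      simpa using Polynomial.coeff_X_pow_mul R d 0
    rw [h0]
    have h1 : Filter.Tendsto (fun r : ℝ => ‖R.eval (r : ℂ)‖) (𝓝[>] 0) (𝓝 ‖R.eval 0‖) := by
      have : Continuous fun r : ℝ => ‖R.eval (r : ℂ)‖ :=
        (R.continuous.comp Complex.continuous_ofReal).norm
      have h2 := this.tendsto 0
      rw [Complex.ofReal_zero] at h2
      exact h2.mono_left nhdsWithin_le_nhds
    have h2 : Filter.Tendsto (fun r : ℝ => B * r ^ (n + 1 - d)) (𝓝[>] 0) (𝓝 0) := by
      have : Continuous fun r : ℝ => B * r ^ (n + 1 - d) := by fun_prop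
      have h2 := this.tendsto 0
      rw [zero_pow (by omega), mul_zero] at h2
      exact h2.mono_left nhdsWithin_le_nhds
    have h3 := le_of_tendsto_of_tendsto h1 h2 <| by
      filter_upwards [h, self_mem_nhdsWithin] with r hr hr0
      have hr0' : 0 < r := hr0
      rw [Polynomial.eval_mul, Polynomial.eval_pow, Polynomial.eval_X, norm_mul, norm_pow,
        Complex.norm_real, Real.norm_of_nonneg hr0'.le] at hr
      have h4 : r ^ (n + 1) = r ^ d * r ^ (n + 1 - d) := by rw [← pow_add]; congr 1; omega
      rw [h4] at hr
      have h5 : 0 < r ^ d := by positivity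
      refine le_of_mul_le_mul_left ?_ h5
      linarith
    exact norm_le_zero_iff.1 h3

theorem infinite_setOf_norm_eq_one : {u : ℂ | ‖u‖ = 1}.Infinite := by
  refine Set.infinite_of_injOn_mapsTo (f := fun x : ℝ => (Circle.exp x : ℂ)) (s := Set.Ioo 0 1)
    ?_ ?_ (Set.Ioo_infinite one_pos)
  · intro x hx y hy hxy
    have h := congrArg Complex.arg hxy
    have hpi := Real.pi_gt_three
    rwa [Circle.arg_exp (by linarith [hx.1]) (by linarith [hx.2]),
      Circle.arg_exp (by linarith [hy.1]) (by linarith [hy.2])] at h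
  · intro x _
    exact Circle.norm_coe _

/-- Along a ray `r u` with `‖u‖ = 1` the sum is a polynomial in `r`, so each homogeneous part
vanishes on the unit circle. There `conj u = u⁻¹`, and multiplication by `u ^ (j + k)` turns the
part into a polynomial in `u` with the distinct exponents `2 j` and infinitely many roots. -/
theorem coeff_eq_zero_of_isBigO {s : Finset (ℕ × ℕ)} {n : ℕ} (hs : ∀ p ∈ s, p.1 + p.2 ≤ n)
    {c : ℕ × ℕ → ℂ}
    (h : (fun z : ℂ => ∑ p ∈ s, c p * z ^ p.1 * conj z ^ p.2) =O[𝓝 0] fun z => ‖z‖ ^ (n + 1)) :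
    ∀ p ∈ s, c p = 0 := by
  intro p₀ hp₀
  obtain ⟨B, hB⟩ := h.bound
  have h1 : ∀ u : ℂ, ‖u‖ = 1 →
      ∑ p ∈ s.filter (fun p => p.1 + p.2 = p₀.1 + p₀.2), c p * u ^ p.1 * conj u ^ p.2 = 0 := by
    intro u hu
    have h2 : ∀ᶠ r : ℝ in 𝓝[>] 0,
        ‖(∑ p ∈ s, Polynomial.C (c p * u ^ p.1 * conj u ^ p.2) *
          Polynomial.X ^ (p.1 + p.2)).eval (r : ℂ)‖ ≤ B * r ^ (n + 1) := by
      have ht : Filter.Tendsto (fun r : ℝ => (r : ℂ) * u) (𝓝[>] 0) (𝓝 0) := by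
        have hc : Continuous fun r : ℝ => (r : ℂ) * u := by fun_prop
        have := hc.tendsto 0
        rw [Complex.ofReal_zero, zero_mul] at this
        exact this.mono_left nhdsWithin_le_nhds
      filter_upwards [ht.eventually hB, self_mem_nhdsWithin] with r hr hr0
      have hr0' : 0 < r := hr0
      have h3 : ‖(r : ℂ) * u‖ = r := by
        rw [norm_mul, hu, mul_one, Complex.norm_real, Real.norm_of_nonneg hr0'.le]
      rw [norm_pow, norm_norm, h3] at hr
      convert hr using 2
      rw [Polynomial.eval_finsetSum]
      refine Finset.sum_congr rfl fun p _ => ?_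
      simp only [Polynomial.eval_mul, Polynomial.eval_C, Polynomial.eval_pow, Polynomial.eval_X,
        map_mul, Complex.conj_ofReal, mul_pow, pow_add]
      ring
    have h3 := polynomial_coeff_eq_zero_of_norm_eval_le h2 (hs p₀ hp₀)
    rw [Polynomial.finsetSum_coeff] at h3
    simp only [Polynomial.coeff_C_mul, Polynomial.coeff_X_pow, mul_ite, mul_one, mul_zero] at h3
    rw [← Finset.sum_filter] at h3
    rw [← h3]
    refine Finset.sum_congr ?_ fun _ _ => rfl
    ext p
    simp only [Finset.mem_filter, eq_comm]
  have h2 : ∑ p ∈ s.filter (fun p => p.1 + p.2 = p₀.1 + p₀.2),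
      Polynomial.C (c p) * Polynomial.X ^ (2 * p.1) = 0 := by
    refine Polynomial.eq_zero_of_infinite_isRoot _ (infinite_setOf_norm_eq_one.mono fun u hu => ?_)
    have hu1 : u * conj u = 1 := by
      rw [Complex.mul_conj, Complex.normSq_eq_norm_sq, hu]
      simp
    have h3 := congrArg (u ^ (p₀.1 + p₀.2) * ·) (h1 u hu)
    simp only [mul_zero, Finset.mul_sum] at h3
    rw [Set.mem_ofPred_eq, Polynomial.IsRoot.def, Polynomial.eval_finsetSum, ← h3]
    refine Finset.sum_congr rfl fun p hp => ?_
    rw [← (Finset.mem_filter.1 hp).2]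
    simp only [Polynomial.eval_mul, Polynomial.eval_C, Polynomial.eval_pow, Polynomial.eval_X]
    calc c p * u ^ (2 * p.1) = c p * u ^ (2 * p.1) * (u * conj u) ^ p.2 := by
          rw [hu1, one_pow, mul_one]
      _ = _ := by rw [mul_pow]; ring
  have h3 := congrArg (Polynomial.coeff · (2 * p₀.1)) h2
  simp only [Polynomial.finsetSum_coeff, Polynomial.coeff_C_mul, Polynomial.coeff_X_pow, mul_ite,
    mul_one, mul_zero, Polynomial.coeff_zero] at h3
  rwa [Finset.sum_eq_single p₀, if_pos rfl] at h3
  · intro p hp hne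
    rw [if_neg]
    intro h4
    have h5 := (Finset.mem_filter.1 hp).2
    exact hne (Prod.ext (by omega) (by omega))
  · intro h4
    exact (h4 (Finset.mem_filter.2 ⟨hp₀, rfl⟩)).elim

/-! ### Polynomial maps of the plane -/

theorem contDiff_planePoly (c : ℂ) (n : ℕ) (u : ℕ × ℕ → ℂ) {k : WithTop ℕ∞} :
    ContDiff ℝ k (planePoly c n u) := by
  have h : ContDiff ℝ k fun z : ℂ => conj z := Complex.conjCLE.contDiff
  unfold planePoly
  fun_prop

theorem norm_planePoly_zero_le (n : ℕ) (u : ℕ × ℕ → ℂ) {z : ℂ} (hz : ‖z‖ ≤ 1) :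
    ‖planePoly 0 n u z‖ ≤ (∑ p ∈ couples n, ‖u p‖) * ‖z‖ ^ 2 := by
  rw [planePoly, zero_mul, zero_add, Finset.sum_mul]
  refine norm_sum_le_of_le _ fun p hp => ?_
  rw [norm_mul, norm_mul, norm_pow, norm_pow, RCLike.norm_conj, mul_assoc, ← pow_add]
  exact mul_le_mul_of_nonneg_left (pow_le_pow_of_le_one (norm_nonneg _) hz (mem_couples.1 hp).1)
    (norm_nonneg _)

theorem exists_lipschitzOnWith_planePoly (c : ℂ) (n : ℕ) (u : ℕ × ℕ → ℂ) :
    ∃ K, ∃ δ > 0, LipschitzOnWith K (planePoly c n u) (Metric.closedBall 0 δ) := by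
  obtain ⟨K, s, hs, hK⟩ := (contDiff_planePoly c n u).contDiffAt (x := 0).exists_lipschitzOnWith
    (𝕂 := ℝ)
  obtain ⟨δ, hδ, hsub⟩ := Metric.nhds_basis_closedBall.mem_iff.1 hs
  exact ⟨K, δ, hδ, hK.mono hsub⟩

theorem polyField_eq (α : ℝ) (n : ℕ) (a : ℕ × ℕ → ℂ) (z : ℂ) :
    polyField α n a z = Complex.I * α * z + planePoly 0 n a z := by
  simp [polyField, planePoly]

theorem planePoly_zero_apply_zero (n : ℕ) (a : ℕ × ℕ → ℂ) : planePoly 0 n a 0 = 0 := by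
  have h := norm_planePoly_zero_le n a (z := 0) (by simp)
  simpa using h

/-! ### Existence of the flow of a polynomial vector field -/

/-- In the rotating frame `z = e^{iαt} u` the linear part disappears and the remaining field is
quadratically small, so Picard–Lindelöf reaches the whole interval `[0, 1]`. -/
theorem exists_isLocalFlow_polyField (α : ℝ) (n : ℕ) (a : ℕ × ℕ → ℂ) :
    ∃ φ, IsLocalFlow (polyField α n a) φ := by
  obtain ⟨K, δ, hδ, hK⟩ := exists_lipschitzOnWith_planePoly 0 n a
  set S := ∑ p ∈ couples n, ‖a p‖ with hS
  have hS0 : 0 ≤ S := Finset.sum_nonneg fun _ _ => norm_nonneg _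
  -- On the ball of radius `ρ` the speed is at most `S ρ² ≤ ρ / 2`; a curve starting within `ρ / 2`
  -- therefore stays in the ball for unit time.
  obtain ⟨ρ, hρ0, hρδ, hρ1, hρS⟩ : ∃ ρ : ℝ, 0 < ρ ∧ ρ ≤ δ ∧ ρ ≤ 1 ∧ S * ρ ≤ 1 / 2 := by
    refine ⟨min δ (min 1 (1 / (2 * (S + 1)))), by positivity, min_le_left _ _,
      (min_le_right _ _).trans (min_le_left _ _), ?_⟩
    have h1 : min δ (min 1 (1 / (2 * (S + 1)))) ≤ 1 / (2 * (S + 1)) :=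
      (min_le_right _ _).trans (min_le_right _ _)
    calc _ ≤ S * (1 / (2 * (S + 1))) := mul_le_mul_of_nonneg_left h1 hS0
      _ ≤ 1 / 2 := by
        rw [mul_one_div, div_le_div_iff₀ (by positivity) (by positivity)]
        linarith
  have hrot : ∀ x : ℝ, ‖Complex.exp (Complex.I * α * x)‖ = 1 := fun x => by
    rw [show Complex.I * α * x = ((α * x : ℝ) : ℂ) * Complex.I by push_cast; ring]
    exact Complex.norm_exp_ofReal_mul_I _
  have hrot' : ∀ x : ℝ, ‖Complex.exp (-(Complex.I * α * x))‖ = 1 := fun x => by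
    rw [show -(Complex.I * α * x) = ((-(α * x) : ℝ) : ℂ) * Complex.I by push_cast; ring]
    exact Complex.norm_exp_ofReal_mul_I _
  have hmem : ∀ t : ℝ, ∀ u ∈ Metric.closedBall (0 : ℂ) ρ,
      Complex.exp (Complex.I * α * t) * u ∈ Metric.closedBall (0 : ℂ) δ := by
    intro t u hu
    rw [mem_closedBall_zero_iff] at hu ⊢
    rw [norm_mul, hrot, one_mul]
    exact hu.trans hρδ
  lift ρ to NNReal using hρ0.le
  have hPL : IsPicardLindelof (fun t u => Complex.exp (-(Complex.I * α * t)) *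
      planePoly 0 n a (Complex.exp (Complex.I * α * t) * u)) (tmin := 0) (tmax := 1)
      ⟨0, by simp⟩ 0 ρ (ρ / 2) (ρ / 2) K := by
    refine ⟨fun t _ => ?_, fun u _ => ?_, fun t _ u hu => ?_, ?_⟩
    · refine LipschitzOnWith.of_dist_le_mul fun u hu v hv => ?_
      have h := hK.dist_le_mul _ (hmem t u hu) _ (hmem t v hv)
      rw [dist_eq_norm, ← mul_sub, norm_mul, hrot', one_mul]
      rwa [dist_eq_norm, dist_eq_norm, ← mul_sub, norm_mul, hrot, one_mul, ← dist_eq_norm u] at h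
    · have hc : Continuous (planePoly 0 n a) := (contDiff_planePoly 0 n a (k := 0)).continuous
      exact Continuous.continuousOn (by fun_prop)
    · rw [mem_closedBall_zero_iff] at hu
      have h := norm_planePoly_zero_le n a (z := Complex.exp (Complex.I * α * t) * u)
        (by rw [norm_mul, hrot, one_mul]; exact hu.trans hρ1)
      rw [norm_mul, hrot, one_mul] at h
      rw [norm_mul, hrot', one_mul]
      refine h.trans ?_
      calc S * ‖u‖ ^ 2 ≤ S * (ρ : ℝ) ^ 2 := by gcongr
        _ = S * ρ * ρ := by ring
        _ ≤ 1 / 2 * ρ := by gcongr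
        _ = _ := by push_cast; ring
    · push_cast
      simp
      linarith
  obtain ⟨u, hu⟩ := hPL.exists_forall_mem_closedBall_eq_forall_mem_Icc_hasDerivWithinAt
  refine ⟨fun t z => Complex.exp (Complex.I * α * t) * u z t, ?_⟩
  have hnhds : Metric.closedBall (0 : ℂ) ((ρ / 2 : NNReal) : ℝ) ∈ 𝓝 0 :=
    Metric.closedBall_mem_nhds _ (by push_cast; linarith)
  filter_upwards [hnhds] with z hz
  obtain ⟨h0, h1⟩ := hu z hz
  refine ⟨by simpa using h0, fun t ht => ?_⟩
  have h2 : HasDerivAt (fun t : ℝ => Complex.exp (Complex.I * α * t))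
      (Complex.exp (Complex.I * α * t) * (Complex.I * α)) t := by
    have := ((Complex.ofRealCLM.hasDerivAt (x := t)).const_mul (Complex.I * α)).cexp
    simpa using this
  refine (h2.hasDerivWithinAt.mul (h1 t ht)).congr_deriv ?_
  have h3 : Complex.exp (Complex.I * α * t) * Complex.exp (-(Complex.I * α * t)) = 1 := by
    rw [← Complex.exp_add]; simp
  rw [polyField_eq]
  linear_combination planePoly 0 n a (Complex.exp (Complex.I * α * t) * u z t) * h3

/-! ### The Taylor expansion of the flow -/

/-- The bound on `X` is only local, so the curve is compared with the barrier `r e^{Mx}`, which `h0`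
keeps inside the `δ`-ball. Taking `r > ‖γ 0‖` keeps the barrier positive even when `γ 0 = 0`, so the
strict bound applies at a contact point. -/
theorem norm_le_mul_exp_of_hasDerivWithinAt {X : ℂ → ℂ} {δ M : ℝ}
    (hM : ∀ w, ‖w‖ ≤ δ → w ≠ 0 → ‖X w‖ < M * ‖w‖) (hM0 : 0 ≤ M) {γ : ℝ → ℂ}
    (hγ : ∀ t ∈ Set.Icc (0 : ℝ) 1, HasDerivWithinAt γ (X (γ t)) (Set.Icc (0 : ℝ) 1) t)
    (h0 : ‖γ 0‖ * Real.exp M < δ) :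
    ∀ t ∈ Set.Icc (0 : ℝ) 1, ‖γ t‖ ≤ ‖γ 0‖ * Real.exp M := by
  have key : ∀ r, ‖γ 0‖ < r → r * Real.exp M ≤ δ →
      ∀ t ∈ Set.Icc (0 : ℝ) 1, ‖γ t‖ ≤ r * Real.exp M := by
    intro r hr hrδ t ht
    have hr0 : 0 < r := (norm_nonneg _).trans_lt hr
    have hle : ∀ x ∈ Set.Icc (0 : ℝ) 1, r * Real.exp (M * x) ≤ r * Real.exp M := by
      intro x hx
      have : M * x ≤ M := mul_le_of_le_one_right hM0 hx.2
      gcongr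
    refine (image_norm_le_of_norm_deriv_right_lt_deriv_boundary (f' := fun t => X (γ t))
      (B := fun x => r * Real.exp (M * x)) (B' := fun x => M * (r * Real.exp (M * x)))
      (fun t ht => (hγ t ht).continuousWithinAt) (fun x hx => ?_) (by simpa using hr.le)
      (fun x => ?_) (fun x hx hB => ?_) ht).trans (hle t ht)
    · exact (hγ x (Set.Ico_subset_Icc_self hx)).mono_of_mem_nhdsWithin (Icc_mem_nhdsGE_of_mem hx)
    · have := (((hasDerivAt_id x).const_mul M).exp).const_mul r
      refine this.congr_deriv ?_
      simp
      ring
    · rw [← hB]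
      refine hM _ ?_ ?_
      · rw [hB]
        exact (hle x (Set.Ico_subset_Icc_self hx)).trans hrδ
      · rw [← norm_pos_iff, hB]
        positivity
  intro t ht
  by_contra hlt
  rw [not_le] at hlt
  have he := Real.exp_pos M
  -- If the bound failed at `t`, such an `r` would give a valid barrier still below `‖γ t‖`.
  obtain ⟨r, hr1, hr2⟩ := exists_between (lt_min ((lt_div_iff₀ he).2 hlt) ((lt_div_iff₀ he).2 h0))
  have h3 := key r hr1 ((le_div_iff₀ he).1 (hr2.le.trans (min_le_right _ _))) t ht
  have h4 := (lt_div_iff₀ he).1 (hr2.trans_le (min_le_left _ _))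
  exact absurd h3 (not_le.2 h4)

/-- The flow of `X` and the jet both solve the polynomial equation up to `O(‖z‖ ^ (n + 1))`,
uniformly on `[0, 1]`, with the same initial value; Gronwall concludes. -/
theorem isLocalFlow_sub_flowJet_isBigO {α : ℝ} {a : ℕ × ℕ → ℂ} {n : ℕ} (hn : 1 ≤ n) {X : ℂ → ℂ}
    (hX : (fun z => X z - polyField α n a z) =O[𝓝 0] fun z => ‖z‖ ^ (n + 1))
    {φ : ℝ → ℂ → ℂ} (hφ : IsLocalFlow X φ) :
    (fun z => φ 1 z - planeEval z (flowJet α a n 1)) =O[𝓝 0] fun z => ‖z‖ ^ (n + 1) := by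
  obtain ⟨K, δ₁, hδ₁, hK⟩ := exists_lipschitzOnWith_planePoly (Complex.I * α) n a
  obtain ⟨D, hD0, hD⟩ := hX.exists_nonneg
  obtain ⟨δ₂, hδ₂, hD⟩ := Metric.nhds_basis_closedBall.mem_iff.1 hD.bound
  obtain ⟨B, hB0, hB⟩ := exists_norm_flowJetDeriv_sub_le α a (n := n)
  obtain ⟨L, hL0, hL⟩ := exists_norm_flowJet_le α a (n := n)
  set δ := min 1 (min δ₁ δ₂) with hδdef
  have hδ : 0 < δ := by positivity
  have hδ1 : δ ≤ 1 := min_le_left _ _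
  -- `K + 1` is nonzero, which selects the closed form of `gronwallBound` used below.
  have hK' : LipschitzOnWith (K + 1) (polyField α n a) (Metric.closedBall 0 δ) :=
    (hK.mono (Metric.closedBall_subset_closedBall
      ((min_le_right _ _).trans (min_le_left _ _)))).weaken (by simp)
  have hD' : ∀ w : ℂ, ‖w‖ ≤ δ → ‖X w - polyField α n a w‖ ≤ D * ‖w‖ ^ (n + 1) := by
    intro w hw
    have := hD (mem_closedBall_zero_iff.2 (hw.trans ((min_le_right _ _).trans (min_le_right _ _))))
    simpa using this
  have hp0 : polyField α n a 0 = 0 := by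
    rw [polyField_eq, planePoly_zero_apply_zero]; simp
  -- Lipschitz constant of the polynomial field, plus the remainder `D`, plus 1 for strictness.
  set M : ℝ := K + 1 + D + 1 with hM
  have hM0 : 0 ≤ M := by positivity
  have hXM : ∀ w, ‖w‖ ≤ δ → w ≠ 0 → ‖X w‖ < M * ‖w‖ := by
    intro w hw hw0
    have hw0' : 0 < ‖w‖ := norm_pos_iff.2 hw0
    have h1 := hK'.norm_sub_le (mem_closedBall_zero_iff.2 hw) (Metric.mem_closedBall_self hδ.le)
    rw [hp0, sub_zero, sub_zero] at h1
    have h2 := hD' w hw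
    have h3 : ‖w‖ ^ (n + 1) ≤ ‖w‖ := by
      conv_rhs => rw [← pow_one ‖w‖]
      exact pow_le_pow_of_le_one (norm_nonneg _) (hw.trans hδ1) (by omega)
    have h4 : ‖X w‖ ≤ ‖X w - polyField α n a w‖ + ‖polyField α n a w‖ := by
      simpa using norm_add_le (X w - polyField α n a w) (polyField α n a w)
    have h5 : D * ‖w‖ ^ (n + 1) ≤ D * ‖w‖ := mul_le_mul_of_nonneg_left h3 hD0
    push_cast at h1
    rw [hM]
    linarith
  set E := Real.exp M with hE
  have hE0 : 0 < E := Real.exp_pos M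
  have hev : ∀ᶠ z : ℂ in 𝓝 0, ‖z‖ * E < δ ∧ L * ‖z‖ < δ ∧ ‖z‖ < 1 := by
    have h1 : Filter.Tendsto (fun z : ℂ => ‖z‖ * E) (𝓝 0) (𝓝 0) := by
      have hc : Continuous fun z : ℂ => ‖z‖ * E := by fun_prop
      simpa using hc.tendsto 0
    have h2 : Filter.Tendsto (fun z : ℂ => L * ‖z‖) (𝓝 0) (𝓝 0) := by
      have hc : Continuous fun z : ℂ => L * ‖z‖ := by fun_prop
      simpa using hc.tendsto 0
    have h3 : Filter.Tendsto (fun z : ℂ => ‖z‖) (𝓝 0) (𝓝 0) := by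
      simpa using (continuous_norm (E := ℂ)).tendsto 0
    exact (h1.eventually (gt_mem_nhds hδ)).and
      ((h2.eventually (gt_mem_nhds hδ)).and (h3.eventually (gt_mem_nhds one_pos)))
  have hK1 : ((K + 1 : NNReal) : ℝ) ≠ 0 := by positivity
  refine Asymptotics.IsBigO.of_bound
    ((D * E ^ (n + 1) + B) / ((K + 1 : NNReal) : ℝ) * (Real.exp ((K + 1 : NNReal) : ℝ) - 1)) ?_
  filter_upwards [hev, hφ] with z ⟨hz1, hz2, hz3⟩ ⟨hφ0, hφ1⟩
  have hbd : ∀ t ∈ Set.Icc (0 : ℝ) 1, ‖φ t z‖ ≤ ‖z‖ * E := by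
    have := norm_le_mul_exp_of_hasDerivWithinAt hXM hM0 (γ := fun t => φ t z) hφ1
      (by rw [hφ0]; exact hz1)
    rwa [hφ0] at this
  have hIco : Set.Ico (0 : ℝ) 1 ⊆ Set.Icc 0 1 := Set.Ico_subset_Icc_self
  have main := dist_le_of_approx_trajectories_ODE_of_mem (a := 0) (b := 1)
    (v := fun _ => polyField α n a) (s := fun _ => Metric.closedBall 0 δ) (K := K + 1)
    (f := fun t => φ t z) (f' := fun t => X (φ t z))
    (g := fun t => planeEval z (flowJet α a n t))
    (g' := fun t => planeEval z (flowJetDeriv α a n t))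
    (εf := D * E ^ (n + 1) * ‖z‖ ^ (n + 1)) (εg := B * ‖z‖ ^ (n + 1)) (δ := 0)
    (fun t _ => hK') (fun t ht => (hφ1 t ht).continuousWithinAt)
    (fun t ht => (hφ1 t (hIco ht)).mono_of_mem_nhdsWithin (Icc_mem_nhdsGE_of_mem ht))
    (fun t ht => ?_) (fun t ht => ?_)
    (fun t _ => (hasDerivAt_planeEval_flowJet α a hn t z).continuousAt.continuousWithinAt)
    (fun t _ => (hasDerivAt_planeEval_flowJet α a hn t z).hasDerivWithinAt)
    (fun t ht => ?_) (fun t ht => ?_)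
    (by rw [hφ0, planeEval_flowJet_zero α a hn, dist_self]) 1 (by simp)
  · rw [gronwallBound_of_K_ne_0 hK1, dist_eq_norm] at main
    rw [norm_pow, norm_norm]
    refine main.trans (le_of_eq ?_)
    beta_reduce
    rw [sub_zero, mul_one]
    ring
  · rw [dist_eq_norm]
    refine (hD' _ ((hbd t (hIco ht)).trans hz1.le)).trans ?_
    have h := pow_le_pow_left₀ (norm_nonneg _) (hbd t (hIco ht)) (n + 1)
    rw [mul_pow] at h
    calc _ ≤ D * (‖z‖ ^ (n + 1) * E ^ (n + 1)) := mul_le_mul_of_nonneg_left h hD0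
      _ = _ := by ring
  · exact mem_closedBall_zero_iff.2 ((hbd t (hIco ht)).trans hz1.le)
  · rw [dist_eq_norm]
    exact hB t (hIco ht) z hz3.le
  · exact mem_closedBall_zero_iff.2 ((hL t (hIco ht) z hz3.le).trans hz2.le)

/-! ### The time-one condition as a system for the coefficients -/

theorem planeEval_flowJet_one_sub_polyMap (α : ℝ) (a f : ℕ × ℕ → ℂ) {n : ℕ} (hn : 1 ≤ n) (z : ℂ) :
    planeEval z (flowJet α a n 1) - polyMap α n f z =
      ∑ p ∈ couples n, (flowCoeff α a p 1 - f p) * z ^ p.1 * conj z ^ p.2 := by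
  rw [planeEval_flowJet α a hn, polyMap, planePoly, planePoly, Complex.ofReal_one, mul_one,
    add_sub_add_left_eq_sub, ← Finset.sum_sub_distrib]
  exact Finset.sum_congr rfl fun p _ => by ring

theorem flowCoeff_eq_of_hasTimeOneMap {α : ℝ} {a f : ℕ × ℕ → ℂ} {n : ℕ} (hn : 1 ≤ n) {X : ℂ → ℂ}
    (hX : (fun z => X z - polyField α n a z) =O[𝓝 0] fun z => ‖z‖ ^ (n + 1))
    (h : HasTimeOneMap X (polyMap α n f) n) : ∀ p ∈ couples n, flowCoeff α a p 1 = f p := by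
  obtain ⟨φ, hφ, hO⟩ := h
  have h1 := hO.sub (isLocalFlow_sub_flowJet_isBigO hn hX hφ)
  simp only [sub_sub_sub_cancel_left, planeEval_flowJet_one_sub_polyMap α a f hn] at h1
  intro p hp
  exact sub_eq_zero.1 (coeff_eq_zero_of_isBigO (c := fun p => flowCoeff α a p 1 - f p)
    (fun p hp => (mem_couples.1 hp).2) h1 p hp)

theorem hasTimeOneMap_polyField_iff {α : ℝ} {a f : ℕ × ℕ → ℂ} {n : ℕ} (hn : 1 ≤ n) :
    HasTimeOneMap (polyField α n a) (polyMap α n f) n ↔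
      ∀ p ∈ couples n, flowCoeff α a p 1 = f p := by
  have hX : (fun z => polyField α n a z - polyField α n a z) =O[𝓝 0] fun z => ‖z‖ ^ (n + 1) := by
    simpa using Asymptotics.isBigO_zero _ _
  refine ⟨flowCoeff_eq_of_hasTimeOneMap hn hX, fun h => ?_⟩
  obtain ⟨φ, hφ⟩ := exists_isLocalFlow_polyField α n a
  refine ⟨φ, hφ, ?_⟩
  have h1 := isLocalFlow_sub_flowJet_isBigO hn hX hφ
  have h2 : ∀ z, planeEval z (flowJet α a n 1) = polyMap α n f z := by
    intro z
    rw [← sub_eq_zero, planeEval_flowJet_one_sub_polyMap α a f hn]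
    exact Finset.sum_eq_zero fun p hp => by rw [h p hp]; ring
  simpa only [h2] using h1

/-! ### Taylor expansion in `z` and `conj z` -/

/-- The couples `(j, k)` with `j + k < m`. -/
def triangle (m : ℕ) : Finset (ℕ × ℕ) :=
  (Finset.range m ×ˢ Finset.range m).filter (fun p => p.1 + p.2 < m)

theorem mem_triangle {m : ℕ} {p : ℕ × ℕ} : p ∈ triangle m ↔ p.1 + p.2 < m := by
  simp only [triangle, Finset.mem_filter, Finset.mem_product, Finset.mem_range]
  omega

section Taylor

variable {E : Type} [NormedAddCommGroup E] [NormedSpace ℂ E]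

/-- `g` is a polynomial of degree less than `m` in `z` and `conj z` with coefficients in `E`. -/
def IsPlanePoly (m : ℕ) (g : ℂ → E) : Prop :=
  ∃ c : ℕ × ℕ → E, ∀ z, g z = ∑ p ∈ triangle m, (z ^ p.1 * conj z ^ p.2) • c p

theorem IsPlanePoly.add {m : ℕ} {g h : ℂ → E} (hg : IsPlanePoly m g) (hh : IsPlanePoly m h) :
    IsPlanePoly m fun z => g z + h z := by
  obtain ⟨c, hc⟩ := hg
  obtain ⟨d, hd⟩ := hh
  exact ⟨fun p => c p + d p, fun z => by
    simp only [hc, hd, smul_add, Finset.sum_add_distrib]⟩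

theorem isPlanePoly_monomial {m : ℕ} {p : ℕ × ℕ} (hp : p.1 + p.2 < m) (e : E) :
    IsPlanePoly m fun z => (z ^ p.1 * conj z ^ p.2) • e := by
  refine ⟨fun q => if q = p then e else 0, fun z => ?_⟩
  simp only [smul_ite, smul_zero]
  rw [Finset.sum_ite_eq', if_pos (mem_triangle.2 hp)]

theorem IsPlanePoly.sum {ι : Type*} {s : Finset ι} {m : ℕ} {g : ι → ℂ → E}
    (hg : ∀ i ∈ s, IsPlanePoly m (g i)) : IsPlanePoly m fun z => ∑ i ∈ s, g i z := by
  choose! c hc using hg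
  refine ⟨fun p => ∑ i ∈ s, c i p, fun z => ?_⟩
  simp only [Finset.smul_sum]
  rw [Finset.sum_comm]
  exact Finset.sum_congr rfl fun i hi => hc i hi z

/-- The splitting of a real-linear map into its complex-linear and antilinear parts; it turns `A p
z` into monomials in `z` and `conj z`. -/
theorem apply_eq_smul_add_conj_smul (A : ℂ →L[ℝ] E) (z : ℂ) :
    A z = z • ((1 / 2 : ℂ) • (A 1 - Complex.I • A Complex.I)) +
      conj z • ((1 / 2 : ℂ) • (A 1 + Complex.I • A Complex.I)) := by
  have h1 : A z = (z.re : ℂ) • A 1 + (z.im : ℂ) • A Complex.I := by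
    conv_lhs => rw [← Complex.re_add_im z]
    rw [show (z.re : ℂ) + z.im * Complex.I = z.re • (1 : ℂ) + z.im • Complex.I by simp, map_add,
      map_smul, map_smul]
    simp
  rw [h1]
  have hz : z = z.re + z.im * Complex.I := (Complex.re_add_im z).symm
  have hz' : conj z = z.re - z.im * Complex.I := by
    apply Complex.ext <;> simp
  rw [hz']
  nth_rewrite 3 [hz]
  have hI := Complex.I_mul_I
  simp only [smul_sub, smul_add, smul_smul]
  have e1 : ((z.re : ℂ) + z.im * Complex.I) * (1 / 2) * Complex.I =
      z.re * Complex.I / 2 - z.im / 2 := by linear_combination (z.im / 2 : ℂ) * hI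
  have e2 : ((z.re : ℂ) - z.im * Complex.I) * (1 / 2) * Complex.I =
      z.re * Complex.I / 2 + z.im / 2 := by linear_combination (-z.im / 2 : ℂ) * hI
  simp only [← mul_assoc, e1, e2]
  module

end Taylor

/-- Induction through the derivative, whence the quantification over `E`: `fderiv ℝ f` takes values
in `ℂ →L[ℝ] E`. Its approximation is integrated along rays from the origin. -/
theorem exists_isPlanePoly_sub_isBigO (m : ℕ) : ∀ {E : Type} [NormedAddCommGroup E]
    [NormedSpace ℂ E] {f : ℂ → E}, ContDiffAt ℝ m f 0 →
    ∃ g : ℂ → E, IsPlanePoly m g ∧ (fun z => f z - g z) =O[𝓝 0] fun z => ‖z‖ ^ m := by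
  induction m with
  | zero =>
    intro E _ _ f hf
    refine ⟨fun _ => 0, ⟨fun _ => 0, fun z => by simp⟩, ?_⟩
    simpa using hf.continuousAt.norm.isBoundedUnder_le.isBigO_one ℝ
  | succ m ih =>
    intro E _ _ f hf
    have hf1 : ContDiffAt ℝ m (fderiv ℝ f) 0 := hf.fderiv_right (by norm_cast)
    obtain ⟨G, ⟨A, hA⟩, hO⟩ := ih hf1
    -- The factor `1 / (j + k + 1)` is the integral of `t ^ (j + k)` over `[0, 1]`.
    refine ⟨fun z => f 0 + ∑ p ∈ triangle m,
      (((p.1 + p.2 + 1 : ℕ) : ℂ)⁻¹ * (z ^ p.1 * conj z ^ p.2)) • A p z, ?_, ?_⟩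
    · refine IsPlanePoly.add ?_ (IsPlanePoly.sum fun p hp => ?_)
      · simpa using isPlanePoly_monomial (m := m + 1) (p := (0, 0)) (by simp) (f 0)
      · have hp' := mem_triangle.1 hp
        have h := (isPlanePoly_monomial (m := m + 1) (p := (p.1 + 1, p.2))
            (by dsimp only; omega) (((p.1 + p.2 + 1 : ℕ) : ℂ)⁻¹ •
              ((1 / 2 : ℂ) • (A p 1 - Complex.I • A p Complex.I)))).add
          (isPlanePoly_monomial (m := m + 1) (p := (p.1, p.2 + 1))
            (by dsimp only; omega) (((p.1 + p.2 + 1 : ℕ) : ℂ)⁻¹ •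
              ((1 / 2 : ℂ) • (A p 1 + Complex.I • A p Complex.I))))
        convert h using 2 with z
        rw [apply_eq_smul_add_conj_smul (A p) z]
        simp only [pow_succ]
        module
    · obtain ⟨C, hC0, hC⟩ := hO.exists_nonneg
      have hdiff : ∀ᶠ w in 𝓝 (0 : ℂ), DifferentiableAt ℝ f w := by
        have h1 := hf.of_le (show ((1 : ℕ) : WithTop ℕ∞) ≤ ((m + 1 : ℕ) : WithTop ℕ∞) by
          norm_cast; omega)
        exact (h1.eventually (by simp)).mono fun w hw => hw.differentiableAt (by simp)
      obtain ⟨δ, hδ, hsub⟩ := Metric.nhds_basis_ball.mem_iff.1 (hdiff.and hC.bound)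
      refine Asymptotics.IsBigO.of_bound C ?_
      filter_upwards [Metric.ball_mem_nhds (0 : ℂ) hδ] with z hz
      rw [mem_ball_zero_iff] at hz
      have hmem : ∀ t ∈ Set.Icc (0 : ℝ) 1, ‖(t : ℂ) * z‖ ≤ ‖z‖ := by
        intro t ht
        rw [norm_mul, Complex.norm_real, Real.norm_of_nonneg ht.1]
        exact mul_le_of_le_one_left (norm_nonneg _) ht.2
      have main := norm_image_sub_le_of_norm_deriv_le_segment_01' (C := C * ‖z‖ ^ (m + 1))
        (f := fun t : ℝ => f ((t : ℂ) * z) - ∑ p ∈ triangle m,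
          t ^ (p.1 + p.2 + 1) •
            (((p.1 + p.2 + 1 : ℕ) : ℂ)⁻¹ * (z ^ p.1 * conj z ^ p.2)) • A p z)
        (f' := fun t : ℝ => (fderiv ℝ f ((t : ℂ) * z) - G ((t : ℂ) * z)) z) (fun t ht => ?_)
        (fun t ht => ?_)
      · rw [norm_pow, norm_norm]
        convert main using 2
        simp
        abel
      · have hd := (hsub (mem_ball_zero_iff.2 ((hmem t ht).trans_lt hz))).1
        have h1 : HasDerivAt (fun t : ℝ => (t : ℂ) * z) z t := by
          simpa using (Complex.ofRealCLM.hasDerivAt (x := t)).mul_const z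
        have h2 := hd.hasFDerivAt.comp_hasDerivAt t h1
        refine (h2.sub (HasDerivAt.fun_sum fun p _ =>
          (hasDerivAt_pow (p.1 + p.2 + 1) t).smul_const _)).hasDerivWithinAt.congr_deriv ?_
        rw [sub_apply, hA, sum_apply]
        congr 1
        refine Finset.sum_congr rfl fun p _ => ?_
        have hne : ((p.1 + p.2 + 1 : ℕ) : ℂ) ≠ 0 := Nat.cast_ne_zero.2 (by omega)
        rw [smul_apply, ← Complex.coe_smul, smul_smul]
        congr 1
        push_cast at hne ⊢
        rw [map_mul, Complex.conj_ofReal, mul_pow, mul_pow, pow_add]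
        field_simp
      · have hd := (hsub (mem_ball_zero_iff.2
          ((hmem t (Set.Ico_subset_Icc_self ht)).trans_lt hz))).2
        have hd' : ‖fderiv ℝ f ((t : ℂ) * z) - G ((t : ℂ) * z)‖ ≤ C * ‖z‖ ^ m := by
          refine le_trans hd ?_
          rw [norm_pow, norm_norm]
          exact mul_le_mul_of_nonneg_left (pow_le_pow_left₀ (norm_nonneg _)
            (hmem t (Set.Ico_subset_Icc_self ht)) m) hC0
        calc _ ≤ ‖fderiv ℝ f ((t : ℂ) * z) - G ((t : ℂ) * z)‖ * ‖z‖ :=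
              ContinuousLinearMap.le_opNorm _ _
          _ ≤ C * ‖z‖ ^ m * ‖z‖ := by gcongr
          _ = _ := by ring

/-- Taylor's polynomial of degree `n`; uniqueness of coefficients applied modulo `‖z‖ ^ 2` forces
its part of degree at most 1 to be `iα z`. -/
theorem IsFieldAtOrigin.exists_sub_polyField_isBigO {α : ℝ} {n : ℕ} (hn : 1 ≤ n) {X : ℂ → ℂ}
    (hX : IsFieldAtOrigin α n X) :
    ∃ a, (fun z => X z - polyField α n a z) =O[𝓝 0] fun z => ‖z‖ ^ (n + 1) := by
  obtain ⟨hd, h2⟩ := hX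
  obtain ⟨g, ⟨c, hc⟩, hO⟩ := exists_isPlanePoly_sub_isBigO (n + 1) hd
  refine ⟨c, ?_⟩
  have hsplit : ∀ z, g z = ∑ p ∈ triangle 2, c p * z ^ p.1 * conj z ^ p.2 + planePoly 0 n c z := by
    intro z
    rw [hc, planePoly, zero_mul, zero_add,
      ← Finset.sum_filter_add_sum_filter_not (triangle (n + 1)) (fun p => p.1 + p.2 < 2)]
    congr 1
    · refine Finset.sum_congr ?_ fun p _ => by rw [smul_eq_mul]; ring
      ext p; simp only [Finset.mem_filter, mem_triangle]; omega
    · refine Finset.sum_congr ?_ fun p _ => by rw [smul_eq_mul]; ring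
      ext p; simp only [Finset.mem_filter, mem_triangle, mem_couples]; omega
  have hlin : ∀ z : ℂ, Complex.I * α * z =
      ∑ p ∈ triangle 2, (if p = (1, 0) then Complex.I * α else 0) * z ^ p.1 * conj z ^ p.2 := by
    intro z
    rw [Finset.sum_eq_single (1, 0)]
    · simp
    · intro p _ hp
      simp [hp]
    · intro h
      exact (h (mem_triangle.2 (by simp))).elim
  have hP : (fun z => planePoly 0 n c z) =O[𝓝 0] fun z : ℂ => ‖z‖ ^ 2 := by
    refine Asymptotics.IsBigO.of_bound (∑ p ∈ couples n, ‖c p‖) ?_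
    filter_upwards [Metric.closedBall_mem_nhds (0 : ℂ) one_pos] with z hz
    rw [norm_pow, norm_norm]
    exact norm_planePoly_zero_le n c (mem_closedBall_zero_iff.1 hz)
  have hO2 : (fun z => X z - g z) =O[𝓝 0] fun z : ℂ => ‖z‖ ^ 2 := by
    refine hO.trans (Asymptotics.IsBigO.of_bound 1 ?_)
    filter_upwards [Metric.closedBall_mem_nhds (0 : ℂ) one_pos] with z hz
    rw [norm_pow, norm_norm, norm_pow, norm_norm, one_mul]
    exact pow_le_pow_of_le_one (norm_nonneg _) (mem_closedBall_zero_iff.1 hz) (by omega)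
  have hlow : (fun z : ℂ => ∑ p ∈ triangle 2,
      (c p - if p = (1, 0) then Complex.I * α else 0) * z ^ p.1 * conj z ^ p.2) =O[𝓝 0]
        fun z => ‖z‖ ^ (1 + 1) := by
    refine ((h2.sub hO2).sub hP).congr_left fun z => ?_
    simp only [sub_mul, Finset.sum_sub_distrib]
    rw [← hlin, hsplit]
    ring
  have hzero := coeff_eq_zero_of_isBigO
    (fun p hp => by have := mem_triangle.1 hp; omega) hlow
  refine hO.congr_left fun z => ?_
  rw [hsplit, polyField_eq, hlin]
  congr 2
  refine Finset.sum_congr rfl fun p hp => ?_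
  rw [sub_eq_zero.1 (hzero p hp)]

/-! ### The recursive procedure -/

/-- The factor of `a_{j,k}` in the equation `φ_{j,k}(1) = f_{j,k}`. -/
noncomputable def resonanceFactor (α : ℝ) (p : ℕ × ℕ) : ℂ :=
  ∫ τ in (0 : ℝ)..1, Complex.exp (Complex.I * ((p.1 : ℂ) - (p.2 : ℂ)) * α * τ) *
    Complex.exp (-(Complex.I * α * τ))

/-- The contribution of the coefficients of lower order to `φ_{j,k}(1)`. -/
noncomputable def lowerIntegral (α : ℝ) (a : ℕ × ℕ → ℂ) (p : ℕ × ℕ) : ℂ :=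
  ∫ τ in (0 : ℝ)..1, lowerCoeff α a p τ * Complex.exp (-(Complex.I * α * τ))

theorem flowCoeff_one (α : ℝ) (a : ℕ × ℕ → ℂ) {p : ℕ × ℕ} (hp : 2 ≤ p.1 + p.2) :
    flowCoeff α a p 1 =
      Complex.exp (Complex.I * α) * (a p * resonanceFactor α p + lowerIntegral α a p) := by
  have hc := continuous_lowerCoeff α a p
  rw [flowCoeff_eq α a hp, resonanceFactor, lowerIntegral, ← intervalIntegral.integral_const_mul (a p),
    ← intervalIntegral.integral_add (Continuous.intervalIntegrable (by fun_prop) _ _)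
      (Continuous.intervalIntegrable (by fun_prop) _ _)]
  simp only [Complex.ofReal_one, mul_one, add_mul, mul_assoc]

theorem lowerIntegral_congr (α : ℝ) {a b : ℕ × ℕ → ℂ} {p : ℕ × ℕ}
    (h : ∀ q : ℕ × ℕ, 2 ≤ q.1 + q.2 → q.1 + q.2 < p.1 + p.2 → a q = b q) :
    lowerIntegral α a p = lowerIntegral α b p := by
  rw [lowerIntegral, lowerCoeff_congr α h, lowerIntegral]

theorem continuous_lowerIntegral (α : ℝ) (p : ℕ × ℕ) :
    Continuous fun a => lowerIntegral α a p := by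
  have h := continuous_lowerCoeff_uncurry α p
  refine intervalIntegral.continuous_parametric_intervalIntegral_of_continuous'
    (f := fun a (τ : ℝ) => lowerCoeff α a p τ * Complex.exp (-(Complex.I * α * τ))) ?_ 0 1
  simp only [Function.uncurry_def]
  fun_prop

/-- With `m = j - k - 1` the integrand is `e^{imατ}`: the integral is 1 if `m = 0`, and `(e^{imα} -
1) / (imα)` otherwise. The sign of `m` is irrelevant, since a number is 1 exactly when its inverse
is. -/
theorem resonanceFactor_eq_zero_iff {α : ℝ} (hα : α ≠ 0) (p : ℕ × ℕ) :
    resonanceFactor α p = 0 ↔ IsResonant α p := by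
  set m : ℤ := (p.1 : ℤ) - p.2 - 1 with hm
  have h1 : resonanceFactor α p = ∫ τ in (0 : ℝ)..1, Complex.exp ((m * (Complex.I * α)) * τ) := by
    rw [resonanceFactor]
    congr 1
    funext τ
    rw [← Complex.exp_add]
    congr 1
    rw [hm]
    push_cast
    ring
  rw [h1, IsResonant, ← hm]
  by_cases h0 : m = 0
  · simp [h0]
  have hc : (m : ℂ) * (Complex.I * α) ≠ 0 :=
    mul_ne_zero (Int.cast_ne_zero.2 h0) (mul_ne_zero Complex.I_ne_zero (by exact_mod_cast hα))
  rw [integral_exp_mul_complex hc, div_eq_zero_iff, or_iff_left hc, sub_eq_zero,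
    Complex.ofReal_one, Complex.ofReal_zero, mul_zero, mul_one, Complex.exp_zero,
    Complex.exp_int_mul, and_iff_right h0]
  rcases Int.natAbs_eq m with h | h
  · conv_lhs => rw [h, zpow_natCast]
  · conv_lhs => rw [h, zpow_neg, zpow_natCast, inv_eq_one]

theorem mem_resonances {α : ℝ} {n : ℕ} {p : ℕ × ℕ} :
    p ∈ resonances α n ↔ p ∈ couples n ∧ IsResonant α p := by
  classical exact Finset.mem_filter

/-- The value of `a_{j,k}` that solves `φ_{j,k}(1) = f_{j,k}` when `(j, k)` is not resonant. -/
noncomputable def solveCoeff (α : ℝ) (f a : ℕ × ℕ → ℂ) (p : ℕ × ℕ) : ℂ :=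
  (f p * Complex.exp (-(Complex.I * α)) - lowerIntegral α a p) / resonanceFactor α p

theorem flowCoeff_one_eq_iff_of_not_isResonant {α : ℝ} (hα : α ≠ 0) {f a : ℕ × ℕ → ℂ} {p : ℕ × ℕ}
    (hp : 2 ≤ p.1 + p.2) (hr : ¬ IsResonant α p) :
    flowCoeff α a p 1 = f p ↔ a p = solveCoeff α f a p := by
  have h1 : resonanceFactor α p ≠ 0 := fun h => hr ((resonanceFactor_eq_zero_iff hα p).1 h)
  have h2 : Complex.exp (Complex.I * α) * Complex.exp (-(Complex.I * α)) = 1 := by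
    rw [← Complex.exp_add]; simp
  rw [flowCoeff_one α a hp, solveCoeff, eq_div_iff h1, eq_sub_iff_add_eq]
  constructor
  · intro h
    rw [← h]
    linear_combination -(a p * resonanceFactor α p + lowerIntegral α a p) * h2
  · intro h
    rw [h]
    linear_combination f p * h2

theorem flowCoeff_one_eq_iff_of_isResonant {α : ℝ} (hα : α ≠ 0) {f a : ℕ × ℕ → ℂ} {p : ℕ × ℕ}
    (hp : 2 ≤ p.1 + p.2) (hr : IsResonant α p) :
    flowCoeff α a p 1 = f p ↔ CompatEq α f a p := by
  rw [flowCoeff_one α a hp, (resonanceFactor_eq_zero_iff hα p).2 hr, mul_zero, zero_add]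
  rfl

open scoped Classical in
/-- The outcome of the recursive procedure up to the order `d`, when the resonant coefficients are
given the values `r`. -/
noncomputable def coeffStage (α : ℝ) (n : ℕ) (f r : ℕ × ℕ → ℂ) : ℕ → ℕ × ℕ → ℂ
  | 0 => 0
  | d + 1 => fun p =>
    if p ∈ couples n ∧ p.1 + p.2 = d + 1 then
      if IsResonant α p then r p else solveCoeff α f (coeffStage α n f r d) p
    else coeffStage α n f r d p

open scoped Classical in
theorem coeffStage_succ (α : ℝ) (n : ℕ) (f r : ℕ × ℕ → ℂ) (d : ℕ) (p : ℕ × ℕ) :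
    coeffStage α n f r (d + 1) p =
      if p ∈ couples n ∧ p.1 + p.2 = d + 1 then
        if IsResonant α p then r p else solveCoeff α f (coeffStage α n f r d) p
      else coeffStage α n f r d p := rfl

theorem coeffStage_eq_zero (α : ℝ) {n : ℕ} (f r : ℕ × ℕ → ℂ) (d : ℕ) {p : ℕ × ℕ}
    (hp : p ∉ couples n) : coeffStage α n f r d p = 0 := by
  induction d with
  | zero => rfl
  | succ d ih => rw [coeffStage_succ, if_neg fun h => hp h.1, ih]

theorem coeffStage_stable (α : ℝ) (n : ℕ) (f r : ℕ × ℕ → ℂ) {d e : ℕ} (hde : d ≤ e) {p : ℕ × ℕ}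
    (hp : p.1 + p.2 ≤ d) : coeffStage α n f r e p = coeffStage α n f r d p := by
  induction e, hde using Nat.le_induction with
  | base => rfl
  | succ e hde ih => rw [coeffStage_succ, if_neg (by omega), ih]

/-- Stages after `p.1 + p.2` leave the value at `p` alone, and `solveCoeff` reads only lower orders,
so the final family satisfies its own recursion. -/
theorem coeffStage_eq (α : ℝ) {n : ℕ} (f r : ℕ × ℕ → ℂ) {p : ℕ × ℕ} (hp : p ∈ couples n) :
    (IsResonant α p → coeffStage α n f r n p = r p) ∧
    (¬ IsResonant α p → coeffStage α n f r n p = solveCoeff α f (coeffStage α n f r n) p) := by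
  have hp' := mem_couples.1 hp
  obtain ⟨d, hd⟩ : ∃ d, p.1 + p.2 = d + 1 := ⟨p.1 + p.2 - 1, by omega⟩
  rw [coeffStage_stable α n f r (show d + 1 ≤ n by omega) hd.le, coeffStage_succ, if_pos ⟨hp, hd⟩]
  refine ⟨fun h => if_pos h, fun h => ?_⟩
  rw [if_neg h, solveCoeff, solveCoeff]
  congr 2
  refine lowerIntegral_congr α fun q _ hq => ?_
  exact (coeffStage_stable α n f r (by omega) (by omega)).symm

theorem continuous_coeffStage (α : ℝ) (n : ℕ) (f : ℕ × ℕ → ℂ) (d : ℕ) {T : Type*}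
    [TopologicalSpace T] {r : T → ℕ × ℕ → ℂ} (hr : Continuous r) :
    Continuous fun c => coeffStage α n f (r c) d := by
  induction d with
  | zero => exact continuous_const
  | succ d ih =>
    refine continuous_pi fun p => ?_
    simp only [coeffStage_succ]
    split_ifs
    · exact (continuous_apply p).comp hr
    · exact (continuous_const.sub ((continuous_lowerIntegral α p).comp ih)).div_const _
    · exact (continuous_apply p).comp ih

theorem coeffFamily_ext {α : ℝ} {n : ℕ} {f a b : ℕ × ℕ → ℂ} (ha : IsCoeffFamily n a)
    (hb : IsCoeffFamily n b)
    (hres : ∀ p ∈ couples n, IsResonant α p → a p = b p)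
    (ha' : ∀ p ∈ couples n, ¬ IsResonant α p → a p = solveCoeff α f a p)
    (hb' : ∀ p ∈ couples n, ¬ IsResonant α p → b p = solveCoeff α f b p) : a = b := by
  have key : ∀ d, ∀ p : ℕ × ℕ, p.1 + p.2 = d → a p = b p := by
    intro d
    induction d using Nat.strong_induction_on with
    | _ d ih =>
      intro p hpd
      by_cases hp : p ∈ couples n
      · by_cases hr : IsResonant α p
        · exact hres p hp hr
        · rw [ha' p hp hr, hb' p hp hr, solveCoeff, solveCoeff]
          congr 2
          exact lowerIntegral_congr α fun q _ hq => ih _ (hpd ▸ hq) q rfl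
      · rw [ha p hp, hb p hp]
  funext p
  exact key _ p rfl

/-- By induction on the order the lower equations already hold, so `CompatSatisfied` applies to the
family just built, whatever the values `r`. -/
theorem flowCoeff_one_coeffStage {α : ℝ} (hα : α ≠ 0) {n : ℕ} {f : ℕ × ℕ → ℂ}
    (hc : ∀ p ∈ resonances α n, CompatSatisfied α f p) (r : ℕ × ℕ → ℂ) :
    ∀ p ∈ couples n, flowCoeff α (coeffStage α n f r n) p 1 = f p := by
  have key : ∀ d, ∀ p ∈ couples n, p.1 + p.2 = d →
      flowCoeff α (coeffStage α n f r n) p 1 = f p := by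
    intro d
    induction d using Nat.strong_induction_on with
    | _ d ih =>
      intro p hp hpd
      have hp' := mem_couples.1 hp
      by_cases hr : IsResonant α p
      · rw [flowCoeff_one_eq_iff_of_isResonant hα hp'.1 hr]
        refine hc p (mem_resonances.2 ⟨hp, hr⟩) _ fun q hq hqp => ?_
        exact ih _ (hpd ▸ hqp) q (mem_couples.2 ⟨hq, by omega⟩) rfl
      · rw [flowCoeff_one_eq_iff_of_not_isResonant hα hp'.1 hr]
        exact (coeffStage_eq α f r hp).2 hr
  exact fun p hp => key _ p hp rfl

/-! ### The three parts of the theorem -/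

theorem exists_continuous_parametrization {α : ℝ} (hα : α ≠ 0) {n : ℕ} (hn : 1 ≤ n)
    {f : ℕ × ℕ → ℂ} {ℓ : ℕ} (hℓ : (resonances α n).card = ℓ)
    (hc : ∀ p ∈ resonances α n, CompatSatisfied α f p) :
    ∃ (e : Fin ℓ ≃ {p // p ∈ resonances α n}) (A : (Fin ℓ → ℂ) → ℕ × ℕ → ℂ),
      Continuous A ∧ (∀ c i, A c (e i) = c i) ∧
      ∀ a : ℕ × ℕ → ℂ,
        (IsCoeffFamily n a ∧ HasTimeOneMap (polyField α n a) (polyMap α n f) n) ↔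
          ∃ c, A c = a := by
  classical
  let e : Fin ℓ ≃ {p // p ∈ resonances α n} := ((resonances α n).equivFinOfCardEq hℓ).symm
  -- The default 0 is never read: `coeffStage` consults `r` only at resonant couples.
  let r : (Fin ℓ → ℂ) → ℕ × ℕ → ℂ := fun c p =>
    if h : p ∈ resonances α n then c (e.symm ⟨p, h⟩) else 0
  have hr : Continuous r := by
    refine continuous_pi fun p => ?_
    by_cases h : p ∈ resonances α n
    · simp only [r, dif_pos h]
      exact continuous_apply _
    · simp only [r, dif_neg h]
      exact continuous_const
  have hre : ∀ c i, r c (e i) = c i := by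
    intro c i
    simp only [r, dif_pos (e i).2, Subtype.coe_eta, Equiv.symm_apply_apply]
  refine ⟨e, fun c => coeffStage α n f (r c) n, continuous_coeffStage α n f n hr, ?_, ?_⟩
  · intro c i
    beta_reduce
    obtain ⟨h1, h2⟩ := mem_resonances.1 (e i).2
    rw [(coeffStage_eq α f (r c) h1).1 h2, hre]
  · intro a
    rw [hasTimeOneMap_polyField_iff hn]
    constructor
    · rintro ⟨ha, hsol⟩
      refine ⟨fun i => a (e i), ?_⟩
      refine coeffFamily_ext (α := α) (f := f) (fun p hp => coeffStage_eq_zero α f _ n hp) ha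
        (fun p hp hres => ?_) (fun p hp => (coeffStage_eq α f _ hp).2) (fun p hp hnr => ?_)
      · beta_reduce
        rw [(coeffStage_eq α f _ hp).1 hres]
        have hmem : p ∈ resonances α n := mem_resonances.2 ⟨hp, hres⟩
        simp only [r, dif_pos hmem, Equiv.apply_symm_apply]
      · exact (flowCoeff_one_eq_iff_of_not_isResonant hα (mem_couples.1 hp).1 hnr).1 (hsol p hp)
    · rintro ⟨c, rfl⟩
      exact ⟨fun p hp => coeffStage_eq_zero α f _ n hp, flowCoeff_one_coeffStage hα hc (r c)⟩

theorem existsUnique_of_forall_not_isResonant {α : ℝ} (hα : α ≠ 0) {n : ℕ} (hn : 1 ≤ n)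
    {f : ℕ × ℕ → ℂ} (h : ∀ p ∈ couples n, ¬ IsResonant α p) :
    ∃! a : ℕ × ℕ → ℂ, IsCoeffFamily n a ∧
      HasTimeOneMap (polyField α n a) (polyMap α n f) n := by
  have hres : resonances α n = ∅ :=
    Finset.eq_empty_of_forall_notMem fun p hp =>
      h p (mem_resonances.1 hp).1 (mem_resonances.1 hp).2
  -- Without resonances the parameter space `Fin 0 → ℂ` is a single point.
  obtain ⟨-, A, -, -, hA⟩ := exists_continuous_parametrization hα hn (f := f) (ℓ := 0)
    (by rw [hres, Finset.card_empty]) (by simp [hres])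
  refine ⟨A 0, (hA _).2 ⟨0, rfl⟩, fun a ha => ?_⟩
  obtain ⟨c, rfl⟩ := (hA a).1 ha
  rw [Subsingleton.elim c 0]

/-- The Taylor coefficients of such a field would solve every equation: those of lower order make
them an admissible choice, and the one at `p` is the compatibility equation. -/
theorem not_hasTimeOneMap_of_compatFails {α : ℝ} (hα : α ≠ 0) {n : ℕ} (hn : 1 ≤ n)
    {f : ℕ × ℕ → ℂ} {p : ℕ × ℕ} (hp : p ∈ couples n) (hr : IsResonant α p)
    (hf : CompatFails α f p) {X : ℂ → ℂ} (hX : IsFieldAtOrigin α n X) :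
    ¬ HasTimeOneMap X (polyMap α n f) n := by
  intro h
  obtain ⟨a, ha⟩ := hX.exists_sub_polyField_isBigO hn
  have hsol := flowCoeff_eq_of_hasTimeOneMap hn ha h
  have hp' := mem_couples.1 hp
  refine hf a (fun q hq hqp => hsol q (mem_couples.2 ⟨hq, by omega⟩)) ?_
  exact (flowCoeff_one_eq_iff_of_isResonant hα hp'.1 hr).1 (hsol p hp)

end TimeOneFlow

theorem theoremp (n : ℕ) (hn : 2 ≤ n) (α : ℝ) (hα : α ∈ Set.Ioo 0 (2 * Real.pi))
    (f : ℕ × ℕ → ℂ) :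
    -- (i) no resonances
    ((∀ p ∈ couples n, ¬ IsResonant α p) →
      ∃! a : ℕ × ℕ → ℂ, IsCoeffFamily n a ∧
        HasTimeOneMap (polyField α n a) (polyMap α n f) n) ∧
    -- (ii) a resonance whose compatibility equation fails
    ((∃ p ∈ couples n, IsResonant α p ∧ CompatFails α f p) →
      ¬ ∃ X : ℂ → ℂ, IsFieldAtOrigin α n X ∧ HasTimeOneMap X (polyMap α n f) n) ∧
    -- (iii) `ℓ` resonances, all of whose compatibility equations are satisfied
    (∀ ℓ : ℕ, (resonances α n).card = ℓ →
      (∀ p ∈ resonances α n, CompatSatisfied α f p) →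
      ∃ (e : Fin ℓ ≃ {p // p ∈ resonances α n}) (A : (Fin ℓ → ℂ) → ℕ × ℕ → ℂ),
        Continuous A ∧
        (∀ c i, A c (e i) = c i) ∧
        ∀ a : ℕ × ℕ → ℂ,
          (IsCoeffFamily n a ∧ HasTimeOneMap (polyField α n a) (polyMap α n f) n) ↔
            ∃ c, A c = a) := by
  have hn1 : 1 ≤ n := by omega
  have hα0 : α ≠ 0 := hα.1.ne'
  refine ⟨existsUnique_of_forall_not_isResonant hα0 hn1, ?_, fun ℓ hℓ hc =>
    exists_continuous_parametrization hα0 hn1 hℓ hc⟩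
  rintro ⟨p, hp, hr, hf⟩ ⟨X, hX, h⟩
  exact not_hasTimeOneMap_of_compatFails hα0 hn1 hp hr hf hX h
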